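/- Let $n\ge 2$ agents move in $\mathbb R^3$ with double-integrator dynamics $\dot p_i=v_i$, $\dot v_i=u_i$ ($p_i$ is differentiable and $v_i$ is an integral of the locally integrable $u_i$). Let $\mathcal G=(\mathcal V,\mathcal E)$ be a digraph on the agents with a leader-follower structure, i.e. $\mathcal G$ is acyclic and has a directed spanning tree whose root is an agent $r$, the leader (from every other vertex the tree contains exactly one directed path to $r$). Put $\mathcal N_i=\{j:(i,j)\in\mathcal E\}$, $m_i=|\mathcal N_i|$, $p_{ij}=p_j-p_i$, $v_{ij}=v_j-v_i$, $g_{ij}=p_{ij}/\|p_{ij}\|$ and $\pi_y=I-yy^\top$. Let $p_i^*,v_i^*,u_i^*:[0,\infty)\to\mathbb R^3$ be desired trajectories with $\dot p_i^*=v_i^*$, $\dot v_i^*=u_i^*$ (in the same sense), and define $p_{ij}^*,v_{ij}^*,g_{ij}^*$ as above. Assume that 1. all $u_i^*(t)$, and $v_{ij}^*(t)$ for $(i,j)\in\mathcal E$, are bounded for $t>0$; 2. the desired bearings are uniformly well defined: there is $\delta>0$ with $\|p_{ij}^*(t)\|\ge\delta$ for all $t>0$ and $(i,j)\in\mathcal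 E$; 3. the desired formation is bearing persistently exciting: for every $i\ne r$ there are $T,\mu>0$ such that $\frac1T\int_t^{t+T}\sum_{j\in\mathcal N_i}\pi_{g_{ij}^*(\tau)}\,d\tau\ge\mu I$ for all $t>0$. Let positive gains $k_{p_i},k_{d_i}$ satisfy $k_{d_i}>\frac1{m_i}$ and $k_{p_i}<\frac4{m_i}-\frac4{k_{d_i}^2m_i^3}$ for every $i\ne r$, and let all agents use the control law $$u_i=\sum_{j\in\mathcal N_i}\bigl[-k_{p_i}\pi_{g_{ij}}p_{ij}^*+k_{d_i}\tilde v_{ij}\bigr]+u_i^*,$$ where $\tilde p_{ij}=p_{ij}-p_{ij}^*$, $\tilde v_{ij}=v_{ij}-v_{ij}^*$ and $\tilde x_{ij}=(\tilde p_{ij},\tilde v_{ij})\in\mathbb R^6$. Then the equilibrium $\tilde x_{ij}=0$ is exponentially stable for all $i\ne r$ and $j\in\mathcal N_i$, along motions without collisions, in the following sense. For a follower $i$ let $X_i(t)$ be the vector of all errors $\tilde x_{kl}(t)$ with $(k,l)\in\mathcal E$ and $k=i$ or $k$ reachable from $i$ by a directed path (the cascade that drives agent $i$). For every $i\ne r$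 and $R>0$ there are $K,c>0$ such that for every $t_0\ge0$ and every closed-loop motion on $[t_0,\infty)$ with $p_{kl}(t)\neq 0$ for all $(k,l)\in\mathcal E$ and $t\ge t_0$, and with $\|X_i(t_0)\|\le R$, $$\|\tilde x_{ij}(t)\|\le K\,\|X_i(t_0)\|\,e^{-c(t-t_0)}\qquad\text{for all } j\in\mathcal N_i,\ t\ge t_0 .$$ -/

import Mathlib

open MeasureTheory
open scoped RealInnerProductSpace

noncomputable section

namespace BearingFormation

/-- Three-dimensional Euclidean space. -/
abbrev E3 := EuclideanSpace ℝ (Fin 3)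

/-! ### Directed graphs -/

/-- A directed path from `a` to `b`: a finite sequence of distinct vertices, starting at `a` and
ending at `b`, each consecutive pair of which is an edge. -/
def IsDirectedPath {V : Type*} (G : Digraph V) (a b : V) (l : List V) : Prop :=
  l.Nodup ∧ l.IsChain G.Adj ∧ l.head? = some a ∧ l.getLast? = some b

/-- No directed cycle (loops count as cycles). -/
def IsAcyclicDigraph {V : Type*} (G : Digraph V) : Prop :=
  ∀ a, ¬ Relation.TransGen G.Adj a a

/-- A directed tree with root `r`: it is acyclic, and every other vertex is connected to the root
by exactly one directed path. -/
def IsDirectedTree {V : Type*} (T : Digraph V) (r : V) : Prop :=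
  IsAcyclicDigraph T ∧ ∀ a, a ≠ r → ∃! l, IsDirectedPath T a r l

/-- Leader-follower structure with leader `r`: the digraph is acyclic and has a directed spanning
tree with root `r`. -/
def IsLeaderFollower {V : Type*} (G : Digraph V) (r : V) : Prop :=
  IsAcyclicDigraph G ∧ ∃ T : Digraph V, T ≤ G ∧ IsDirectedTree T r

open Classical in
/-- The set `𝒩ᵢ` of neighbours of agent `i` (the agents sensed by `i`). -/
def nbrs {n : ℕ} (G : Digraph (Fin n)) (i : Fin n) : Finset (Fin n) :=
  Finset.univ.filter (fun j => G.Adj i j)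

/-- `mᵢ`, the number of neighbours of agent `i`. -/
def outDeg {n : ℕ} (G : Digraph (Fin n)) (i : Fin n) : ℕ := (nbrs G i).card

open Classical in
/-- Agent `i` together with all agents that can be reached from `i` along directed edges, that is,
the agents on which the motion of `i` depends. -/
def reach {n : ℕ} (G : Digraph (Fin n)) (i : Fin n) : Finset (Fin n) :=
  Finset.univ.filter (fun k => Relation.ReflTransGen G.Adj i k)

/-! ### Bearings and persistence of excitation -/

/-- The bearing `x / ‖x‖` of a relative position `x`. -/
def bearing (x : E3) : E3 := ‖x‖⁻¹ • x

/-- The operator `π_y = I - y yᵀ`. -/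
def proj (y : E3) : E3 →L[ℝ] E3 :=
  ContinuousLinearMap.id ℝ E3 - (innerSL ℝ y).smulRight y

/-- Persistence of excitation of an operator-valued function of time:
`(1/T) ∫ₜᵗ⁺ᵀ Σ(τ) dτ ≥ μ I` for all `t > 0`, in the Loewner order. -/
def IsPE (S : ℝ → E3 →L[ℝ] E3) : Prop :=
  ∃ T : ℝ, 0 < T ∧ ∃ μ : ℝ, 0 < μ ∧ ∀ t : ℝ, 0 < t →
    μ • ContinuousLinearMap.id ℝ E3 ≤ (1 / T) • ∫ τ in t..(t + T), S τ

/-- The relative vector `qᵢⱼ(t) = qⱼ(t) - qᵢ(t)` (relative position or relative velocity). -/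
def rel {n : ℕ} (q : Fin n → ℝ → E3) (i j : Fin n) (t : ℝ) : E3 := q j t - q i t

/-- A formation is bearing persistently exciting if `∑ j ∈ 𝒩ᵢ, π_{gᵢⱼ(t)}` is persistently exciting
for every agent `i` other than the leader `r` (which has no neighbours). -/
def IsBearingPE {n : ℕ} (G : Digraph (Fin n)) (r : Fin n) (p : Fin n → ℝ → E3) : Prop :=
  ∀ i, i ≠ r → IsPE (fun t => ∑ j ∈ nbrs G i, proj (bearing (rel p i j t)))

/-! ### Dynamics -/

/-- `p' = v`, `v' = u` on `[t₀, ∞)`. The second equation is meant in the sense of Caratheodory: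
`u` is locally integrable and `v` is an integral of `u`. -/
def IsDoubleIntegrator (t₀ : ℝ) (p v u : ℝ → E3) : Prop :=
  ∀ t ≥ t₀, HasDerivWithinAt p (v t) (Set.Ici t₀) t ∧
    IntervalIntegrable u volume t₀ t ∧ v t = v t₀ + ∫ s in t₀..t, u s

/-- The control law
`uᵢ = ∑ j ∈ 𝒩ᵢ, (- k_{pᵢ} π_{gᵢⱼ} p*ᵢⱼ + k_{dᵢ} ṽᵢⱼ) + uᵢ*`, with `ṽᵢⱼ = vᵢⱼ - v*ᵢⱼ`. The desired
trajectories are `pd`, `vd`, `ud`, the actual ones `p`, `v`. -/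
def control {n : ℕ} (G : Digraph (Fin n)) (kp kd : Fin n → ℝ) (pd vd ud p v : Fin n → ℝ → E3)
    (i : Fin n) (t : ℝ) : E3 :=
  ∑ j ∈ nbrs G i, (-(kp i • proj (bearing (rel p i j t)) (rel pd i j t))
      + kd i • (rel v i j t - rel vd i j t)) + ud i t

/-- `(p, v)` is a closed-loop motion on `[t₀, ∞)` along which the bearings of all edges are well
defined (no collision of neighbours). -/
def IsClosedLoopSolution {n : ℕ} (G : Digraph (Fin n)) (kp kd : Fin n → ℝ)
    (pd vd ud : Fin n → ℝ → E3) (t₀ : ℝ) (p v : Fin n → ℝ → E3) : Prop :=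
  (∀ i, IsDoubleIntegrator t₀ (p i) (v i) (control G kp kd pd vd ud p v i)) ∧
  ∀ i j, G.Adj i j → ∀ t ≥ t₀, rel p i j t ≠ 0

/-- The relative error `x̃ᵢⱼ = (p̃ᵢⱼ, ṽᵢⱼ)`, with the Euclidean norm of `ℝ⁶`. -/
def relError {n : ℕ} (pd vd p v : Fin n → ℝ → E3) (i j : Fin n) (t : ℝ) : WithLp 2 (E3 × E3) :=
  WithLp.toLp 2 (rel p i j t - rel pd i j t, rel v i j t - rel vd i j t)

/-- Euclidean norm of the state of the cascade that drives agent `i`, i.e. of the stacked errors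
`x̃ₖₗ` of all edges `(k, l)` whose tail `k` is `i` or reachable from `i`. -/
def cascadeErrorNorm {n : ℕ} (G : Digraph (Fin n)) (pd vd p v : Fin n → ℝ → E3) (i : Fin n)
    (t : ℝ) : ℝ :=
  √(∑ k ∈ reach G i, ∑ l ∈ nbrs G k, ‖relError pd vd p v k l t‖ ^ 2)

end BearingFormation

end

/-!
Write `yᵢ`, `wᵢ` for the position and velocity errors of agent `i` relative to those of the leader.
The errors `x̃ᵢⱼ` are differences of these (`rel_sub_rel`). Since `π_{gᵢⱼ} pᵢⱼ = 0`, the control law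
reads `wᵢ' = ∑ j, (k_p π_{gᵢⱼ} (yⱼ - yᵢ) + k_d (wⱼ - wᵢ))`, with a right-hand side continuous in time.

For one agent with `m` neighbours put `a = k_d m`. The function `V = ½|a y + w|² + ½|w|²` decreases
at a rate at least a multiple of `∑ j, (|w|² + |π_{gᵢⱼ} (y - yⱼ)|²)`, up to terms due to the neighbours
(`exists_lyap_deriv_le`). This needs only `a ≥ 1` and `k_p m < a²`, which follow from the gain
conditions, and holds for arbitrary bearings. So `V` stays bounded (`le_mul_exp_of_deriv_le`).

The excitation hypothesis concerns the desired bearings, while the dissipation involves the actual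
ones. The two are linked by the identity `|p*| |π_{g*} (p* - p)| = |p| |π_g (p* - p)|`
(`norm_mul_norm_proj_bearing_sub`): both sides are twice the area of the triangle spanned by `p` and
`p*`. Together with `|p*| ≥ δ` and the bound on the errors, it bounds the desired projections of the
errors by the actual ones. Integrating over one period of excitation gives
`V (t + T) ≤ ρ V t + A F² e^{-c (t - t₀)}` with `ρ < 1` (`IsDrivenMotion.exists_contraction`), hence
exponential decay, with constants depending on the motion only through the bound on the initial errors
(`exists_decay_of_driven`).

The digraph is acyclic, so that the agents can be treated by well-founded induction, each one driven
by neighbours whose errors are already known to decay (`exists_agentDecay`). Every follower has a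
neighbour, which bounds its initial error relative to the leader by the error of the cascade.
-/

namespace BearingFormation

/-! ### The projections onto the orthogonal complement of a bearing -/

lemma proj_bearing_apply (q x : E3) :
    proj (bearing q) x = x - ((‖q‖⁻¹) ^ 2 * ⟪q, x⟫) • q := by
  simp only [proj, bearing, sub_apply, ContinuousLinearMap.id_apply,
    ContinuousLinearMap.smulRight_apply, innerSL_apply_apply, real_inner_smul_left, smul_smul]
  congr 2
  ring

lemma proj_bearing_apply_self (q : E3) : proj (bearing q) q = 0 := by
  rcases eq_or_ne q 0 with rfl | hq
  · simp
  · have : ‖q‖ ≠ 0 := norm_ne_zero_iff.mpr hq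
    rw [proj_bearing_apply, real_inner_self_eq_norm_sq, ← mul_pow, inv_mul_cancel₀ this]
    simp

lemma inner_proj_bearing_self (q x : E3) :
    ⟪x, proj (bearing q) x⟫ = ‖x‖ ^ 2 - (‖q‖⁻¹ * ⟪q, x⟫) ^ 2 := by
  rw [proj_bearing_apply, inner_sub_right, real_inner_self_eq_norm_sq, real_inner_smul_right,
    real_inner_comm]
  ring

lemma norm_sq_proj_bearing (q x : E3) :
    ‖proj (bearing q) x‖ ^ 2 = ‖x‖ ^ 2 - (‖q‖⁻¹ * ⟪q, x⟫) ^ 2 := by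
  rcases eq_or_ne q 0 with rfl | hq
  · simp [proj_bearing_apply]
  · have h : ‖q‖ ≠ 0 := norm_ne_zero_iff.mpr hq
    rw [proj_bearing_apply, norm_sub_sq_real, real_inner_smul_right, norm_smul, mul_pow,
      Real.norm_eq_abs, sq_abs, real_inner_comm]
    field_simp
    ring

lemma inner_proj_bearing (q x : E3) : ⟪x, proj (bearing q) x⟫ = ‖proj (bearing q) x‖ ^ 2 := by
  rw [inner_proj_bearing_self, norm_sq_proj_bearing]

lemma norm_proj_bearing_le (q x : E3) : ‖proj (bearing q) x‖ ≤ ‖x‖ := by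
  refine le_of_sq_le_sq ?_ (norm_nonneg _)
  rw [norm_sq_proj_bearing]
  linarith [sq_nonneg (‖q‖⁻¹ * ⟪q, x⟫)]

/-- Twice the area of the triangle with sides `p` and `q`, computed with either side as base. This
is what turns excitation of the desired bearings into excitation of the actual ones. -/
lemma norm_mul_norm_proj_bearing_sub (p q : E3) :
    ‖p‖ * ‖proj (bearing p) (p - q)‖ = ‖q‖ * ‖proj (bearing q) (p - q)‖ := by
  have key : ∀ a b : E3, (‖a‖ * ‖proj (bearing a) b‖) ^ 2 = ‖a‖ ^ 2 * ‖b‖ ^ 2 - ⟪a, b⟫ ^ 2 := by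
    intro a b
    rcases eq_or_ne a 0 with rfl | ha
    · simp
    · have h : ‖a‖ ≠ 0 := norm_ne_zero_iff.mpr ha
      rw [mul_pow, norm_sq_proj_bearing]
      field_simp
  rw [map_sub, map_sub, proj_bearing_apply_self, proj_bearing_apply_self, zero_sub, norm_neg,
    sub_zero]
  rw [← sq_eq_sq₀ (by positivity) (by positivity), key, key, real_inner_comm]
  ring

lemma norm_proj_bearing_sub_le {δ B : ℝ} (hδ : 0 < δ) {p e : E3} (hp : δ ≤ ‖p‖) (he : ‖e‖ ≤ B) :
    ‖proj (bearing p) e‖ ≤ (1 + B / δ) * ‖proj (bearing (p - e)) e‖ := by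
  have h := norm_mul_norm_proj_bearing_sub p (p - e)
  rw [sub_sub_cancel] at h
  have hp0 : 0 < ‖p‖ := hδ.trans_le hp
  have hB : 0 ≤ B := (norm_nonneg e).trans he
  have h1 : ‖p - e‖ ≤ (1 + B / δ) * ‖p‖ := by
    have : B ≤ B / δ * ‖p‖ := by
      rw [div_mul_eq_mul_div, le_div_iff₀ hδ]
      exact mul_le_mul_of_nonneg_left hp hB
    linarith [norm_sub_le p e]
  refine le_of_mul_le_mul_left ?_ hp0
  rw [h]
  calc _ ≤ ((1 + B / δ) * ‖p‖) * ‖proj (bearing (p - e)) e‖ := by gcongr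
    _ = _ := by ring

lemma continuousOn_proj_bearing {q : ℝ → E3} {s : Set ℝ} (hq : ContinuousOn q s)
    (h0 : ∀ t ∈ s, q t ≠ 0) : ContinuousOn (fun t => proj (bearing (q t))) s := by
  have hb : ContinuousOn (fun t => bearing (q t)) s :=
    (hq.norm.inv₀ fun t ht => norm_ne_zero_iff.mpr (h0 t ht)).smul hq
  have hc : Continuous (proj : E3 → E3 →L[ℝ] E3) := by
    unfold proj
    refine continuous_const.sub ?_
    exact ((ContinuousLinearMap.smulRightL ℝ E3 E3).continuous₂).comp₂
      (innerSL ℝ).continuous continuous_id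
  exact hc.comp_continuousOn hb

/-! ### Scalar inequalities -/

/-- Contraction over a period up to an exponentially small error gives exponential decay, with
constants that depend only on the period and the rates. -/
lemma exists_exp_decay_of_contraction {T ρ c : ℝ} (hT : 0 < T) (hρ0 : 0 ≤ ρ) (hρ : ρ < 1)
    (hc : 0 < c) : ∃ K > 0, ∃ c' > 0, ∀ (t₀ M : ℝ) (V : ℝ → ℝ), 0 ≤ M →
      (∀ t ≥ t₀, V t ≤ M) →
      (∀ t > t₀, V (t + T) ≤ ρ * V t + M * Real.exp (-c * (t - t₀))) →
      ∀ t ≥ t₀, V t ≤ K * M * Real.exp (-c' * (t - t₀)) := by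
  obtain ⟨c', hc', hle, hlt⟩ : ∃ c' > 0, c' ≤ c ∧ ρ * Real.exp (c' * T) < 1 := by
    have hcont : Filter.Tendsto (fun x : ℝ => ρ * Real.exp (x * T)) (nhdsWithin 0 (Set.Ioi 0))
        (nhds (ρ * Real.exp (0 * T))) :=
      (Continuous.tendsto (by fun_prop) _).mono_left nhdsWithin_le_nhds
    have h1 := hcont.eventually_lt_const (u := 1) (by simpa using hρ)
    have h2 : ∀ᶠ x : ℝ in nhdsWithin 0 (Set.Ioi 0), x ∈ Set.Ioc 0 c := Ioc_mem_nhdsGT hc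
    obtain ⟨x, hx1, hx2⟩ := (h1.and h2).exists
    exact ⟨x, hx2.1, hx2.2, hx1⟩
  set E := Real.exp (c' * T) with hE
  have hE1 : 1 ≤ E := Real.one_le_exp (by positivity)
  have hd : 0 < 1 - ρ * E := by linarith
  -- the fixed point of `K ↦ ρ E K + E`
  set K := E / (1 - ρ * E) with hK
  have hKE : ρ * E * K + E = K := by rw [hK]; field_simp; ring
  have hK0 : 0 < K := by positivity
  have hEK : E ≤ K := by
    have : 0 ≤ ρ * E * K := by positivity
    linarith
  refine ⟨K, hK0, c', hc', fun t₀ M V hM hb hV => ?_⟩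
  have step : ∀ (k : ℕ), ∀ t ≥ t₀, t ≤ t₀ + (k + 1) * T →
      V t ≤ K * M * Real.exp (-c' * (t - t₀)) := by
    intro k
    have base : ∀ t ≥ t₀, t ≤ t₀ + T → V t ≤ K * M * Real.exp (-c' * (t - t₀)) := by
      intro t ht htT
      have h1 : 1 ≤ E * Real.exp (-c' * (t - t₀)) := by
        rw [hE, ← Real.exp_add]
        exact Real.one_le_exp (by nlinarith)
      calc V t ≤ M * 1 := by simpa using hb t ht
        _ ≤ M * (E * Real.exp (-c' * (t - t₀))) := by gcongr
        _ ≤ M * (K * Real.exp (-c' * (t - t₀))) := by gcongr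
        _ = _ := by ring
    induction k with
    | zero => intro t ht h; exact base t ht (by simpa using h)
    | succ k ih =>
      intro t ht h
      rcases le_or_gt t (t₀ + T) with h' | h'
      · exact base t ht h'
      · have h1 := hV (t - T) (by linarith)
        have h2 := ih (t - T) (by linarith) (by push_cast at h; linarith)
        rw [sub_add_cancel] at h1
        have e1 : Real.exp (-c' * (t - T - t₀)) = E * Real.exp (-c' * (t - t₀)) := by
          rw [hE, ← Real.exp_add]; congr 1; ring
        have e2 : Real.exp (-c * (t - T - t₀)) ≤ E * Real.exp (-c' * (t - t₀)) := by
          rw [← e1]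
          exact Real.exp_le_exp.mpr (by nlinarith)
        rw [e1] at h2
        calc V t ≤ ρ * (K * M * (E * Real.exp (-c' * (t - t₀))))
              + M * (E * Real.exp (-c' * (t - t₀))) := by
              refine h1.trans ?_
              gcongr
          _ = (ρ * E * K + E) * M * Real.exp (-c' * (t - t₀)) := by ring
          _ = _ := by rw [hKE]
  intro t ht
  obtain ⟨k, hk⟩ := exists_nat_ge ((t - t₀) / T)
  refine step k t ht ?_
  rw [div_le_iff₀ hT] at hk
  linarith

/-- A Grönwall inequality with the integrable rate `C e^{-c (t - t₀)}`. -/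
lemma le_mul_exp_of_deriv_le {t₀ C c : ℝ} (hc : 0 < c) (hC : 0 ≤ C) {Z Z' : ℝ → ℝ}
    (hZ : ∀ t ≥ t₀, HasDerivWithinAt Z (Z' t) (Set.Ici t₀) t) (hZ0 : ∀ t ≥ t₀, 0 ≤ Z t)
    (hle : ∀ t ≥ t₀, Z' t ≤ C * Real.exp (-c * (t - t₀)) * Z t) :
    ∀ t ≥ t₀, Z t ≤ Real.exp (C / c) * Z t₀ := by
  -- multiply by the exponential of the remaining integral of the rate
  let Y : ℝ → ℝ := fun t => Z t * Real.exp (C / c * Real.exp (-c * (t - t₀)))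
  have hY : ∀ t ≥ t₀, HasDerivWithinAt Y
      (Z' t * Real.exp (C / c * Real.exp (-c * (t - t₀))) +
        Z t * (Real.exp (C / c * Real.exp (-c * (t - t₀))) *
          (C / c * (Real.exp (-c * (t - t₀)) * -c)))) (Set.Ici t₀) t := by
    intro t ht
    have h1 : HasDerivAt (fun t => -c * (t - t₀)) (-c) t := by
      simpa using ((hasDerivAt_id t).sub_const t₀).const_mul (-c)
    exact (hZ t ht).mul ((h1.exp.const_mul (C / c)).exp.hasDerivWithinAt)
  have hanti : AntitoneOn Y (Set.Ici t₀) := by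
    refine antitoneOn_of_hasDerivWithinAt_nonpos (convex_Ici t₀)
      (fun t ht => (hY t ht).continuousWithinAt)
      (fun t ht => (hY t (interior_subset ht)).mono interior_subset) ?_
    intro t ht
    have h := hle t (interior_subset ht)
    have : C / c * (Real.exp (-c * (t - t₀)) * -c) = -(C * Real.exp (-c * (t - t₀))) := by
      field_simp
    rw [this]
    have hE := Real.exp_pos (C / c * Real.exp (-c * (t - t₀)))
    nlinarith [mul_le_mul_of_nonneg_right h hE.le]
  intro t ht
  have h := hanti (Set.mem_Ici.mpr le_rfl) ht ht
  simp only [Y, sub_self, mul_zero, Real.exp_zero, mul_one] at h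
  have h1 : 1 ≤ Real.exp (C / c * Real.exp (-c * (t - t₀))) := Real.one_le_exp (by positivity)
  nlinarith [hZ0 t ht]

lemma sq_integral_le {f : ℝ → ℝ} {a b : ℝ} (hab : a ≤ b) (hf : ContinuousOn f (Set.Icc a b)) :
    (∫ s in a..b, f s) ^ 2 ≤ (b - a) * ∫ s in a..b, f s ^ 2 := by
  rcases hab.eq_or_lt with rfl | hlt
  · simp
  rw [← Set.uIcc_of_le hab] at hf
  set J := ∫ s in a..b, f s with hJ
  have h1 : IntervalIntegrable f volume a b := hf.intervalIntegrable
  have h2 : IntervalIntegrable (fun s => f s ^ 2) volume a b := (hf.pow 2).intervalIntegrable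
  have h0 : 0 ≤ ∫ s in a..b, ((b - a) * f s - J) ^ 2 :=
    intervalIntegral.integral_nonneg hab fun s _ => sq_nonneg _
  have e : ∀ s, ((b - a) * f s - J) ^ 2 = (b - a) ^ 2 * f s ^ 2 - 2 * (b - a) * J * f s + J ^ 2 :=
    fun s => by ring
  simp only [e] at h0
  rw [intervalIntegral.integral_add ((h2.const_mul _).sub (h1.const_mul _)) (by simp),
    intervalIntegral.integral_sub (h2.const_mul _) (h1.const_mul _),
    intervalIntegral.integral_const_mul, intervalIntegral.integral_const_mul, ← hJ,
    intervalIntegral.integral_const, smul_eq_mul] at h0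
  have hpos : 0 < b - a := by linarith
  refine le_of_mul_le_mul_left ?_ hpos
  nlinarith

/-- A positive definite quadratic form in two variables dominates a multiple of the sum of the
squares. -/
lemma exists_mul_le_quadratic {α β γ : ℝ} (hα : 0 < α) (hβ : 0 < β) (h : γ ^ 2 < α * β) :
    ∃ ε > 0, ∀ x y : ℝ, ε * (x ^ 2 + y ^ 2) ≤ α * x ^ 2 - 2 * γ * x * y + β * y ^ 2 := by
  have hs : 0 < α + β := by positivity
  set ε := (α * β - γ ^ 2) / (α + β) with hε
  have hεs : ε * (α + β) = α * β - γ ^ 2 := by rw [hε]; field_simp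
  have hε0 : 0 < ε := by rw [hε]; apply div_pos <;> linarith
  have hεα : 0 < α - ε := by
    have : ε * (α + β) < α * (α + β) := by nlinarith [sq_nonneg γ]
    linarith [lt_of_mul_lt_mul_right this hs.le]
  refine ⟨ε, hε0, fun x y => ?_⟩
  have h1 : 0 ≤ (α - ε) * ((α - ε) * x ^ 2 - 2 * γ * x * y + (β - ε) * y ^ 2) := by
    have : (α - ε) * ((α - ε) * x ^ 2 - 2 * γ * x * y + (β - ε) * y ^ 2)
        = ((α - ε) * x - γ * y) ^ 2 + ε ^ 2 * y ^ 2 := by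
      linear_combination (-y ^ 2) * hεs
    rw [this]; positivity
  have := nonneg_of_mul_nonneg_right h1 hεα
  linarith

/-! ### A single agent driven by its neighbours -/

/-- Quadratic form in the position error `y` and the velocity error `w`, used as a Lyapunov
function for `y'' = -a y' - k Q(t) y` with a time-varying positive semidefinite `Q`. -/
noncomputable def lyap (a : ℝ) (y w : E3) : ℝ := 1 / 2 * ‖a • y + w‖ ^ 2 + 1 / 2 * ‖w‖ ^ 2

lemma lyap_nonneg (a : ℝ) (y w : E3) : 0 ≤ lyap a y w := by unfold lyap; positivity

lemma norm_vel_sq_le_lyap (a : ℝ) (y w : E3) : ‖w‖ ^ 2 ≤ 2 * lyap a y w := by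
  unfold lyap
  linarith [sq_nonneg ‖a • y + w‖]

lemma norm_pos_sq_le_lyap {a : ℝ} (ha : 1 ≤ a) (y w : E3) : ‖y‖ ^ 2 ≤ 4 * lyap a y w := by
  have h1 : ‖y‖ ≤ ‖a • y + w‖ + ‖w‖ := by
    calc ‖y‖ ≤ a * ‖y‖ := le_mul_of_one_le_left (norm_nonneg _) ha
      _ = ‖a • y‖ := by rw [norm_smul, Real.norm_of_nonneg (by linarith)]
      _ = ‖(a • y + w) - w‖ := by rw [add_sub_cancel_right]
      _ ≤ _ := norm_sub_le _ _
  have h2 := pow_le_pow_left₀ (norm_nonneg y) h1 2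
  unfold lyap
  nlinarith [sq_nonneg (‖a • y + w‖ - ‖w‖)]

lemma lyap_le (a : ℝ) (y w : E3) : lyap a y w ≤ a ^ 2 * ‖y‖ ^ 2 + 2 * ‖w‖ ^ 2 := by
  have h1 : ‖a • y + w‖ ≤ |a| * ‖y‖ + ‖w‖ := by
    simpa [norm_smul] using norm_add_le (a • y) w
  have h2 := pow_le_pow_left₀ (norm_nonneg _) h1 2
  unfold lyap
  nlinarith [sq_nonneg (|a| * ‖y‖ - ‖w‖), sq_abs a, sq_nonneg ‖w‖]

lemma hasDerivWithinAt_lyap {a t : ℝ} {s : Set ℝ} {y w : ℝ → E3} {y' w' : E3}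
    (hy : HasDerivWithinAt y y' s t) (hw : HasDerivWithinAt w w' s t) :
    HasDerivWithinAt (fun t => lyap a (y t) (w t))
      (⟪a • y t + w t, a • y' + w'⟫ + ⟪w t, w'⟫) s t := by
  have h1 := ((hy.const_smul a).add hw).norm_sq
  have h2 := hw.norm_sq
  refine ((h1.const_mul (1 / 2)).add (h2.const_mul (1 / 2))).congr_deriv ?_
  simp only [Pi.add_apply, Pi.smul_apply]
  ring

variable {ι : Type*}

/-- Acceleration that the control law gives to an agent with position error `y` and velocity error
`w`, when its neighbours have errors `η j` and `ω j` and the relative positions are `q j`. -/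
noncomputable def accel (N : Finset ι) (kp kd : ℝ) (q η ω : ι → E3) (y w : E3) : E3 :=
  ∑ j ∈ N, (kp • proj (bearing (q j)) (η j - y) + kd • (ω j - w))

/-- The quantity `∑ j, (‖w‖² + ‖π (y - η j)‖²)` a multiple of which bounds the rate of
decrease of `lyap` from below when the neighbours have no errors. -/
noncomputable def dissipation (N : Finset ι) (q η : ι → E3) (y w : E3) : ℝ :=
  ∑ j ∈ N, (‖w‖ ^ 2 + ‖proj (bearing (q j)) (y - η j)‖ ^ 2)

/-- The Lyapunov function decreases at the dissipation rate, up to the influence of the neighbours,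
whatever the bearings are. The hypothesis `kp < kd ^ 2 * N.card` is exactly positive definiteness of
the quadratic form in `‖w‖` and `‖π (y - η j)‖` contributed by each neighbour. -/
lemma exists_lyap_deriv_le (N : Finset ι) {kp kd : ℝ} (hkp : 0 < kp) (hkd : 0 < kd)
    (ha : 1 ≤ kd * N.card) (hgain : kp < kd ^ 2 * N.card) :
    ∃ ε > 0, ∃ C ≥ 0, ∀ (q η ω : ι → E3) (y w : E3) (F h : ℝ), 0 ≤ F → 0 ≤ h → h ≤ 1 →
      (∀ j ∈ N, ‖η j‖ ≤ F * h ∧ ‖ω j‖ ≤ F * h) →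
      ⟪(kd * N.card) • y + w, (kd * N.card) • w + accel N kp kd q η ω y w⟫
          + ⟪w, accel N kp kd q η ω y w⟫
        ≤ -ε * dissipation N q η y w + C * h * (lyap (kd * N.card) y w + F ^ 2) := by
  set a : ℝ := kd * N.card with ha'
  have ha0 : 0 < a := by linarith
  obtain ⟨ε, hε, hquad⟩ := exists_mul_le_quadratic (α := kd) (β := kp * a) (γ := kp) hkd
    (by positivity) (by rw [ha']; nlinarith)
  refine ⟨ε, hε, N.card * (3 * kp * a + 2 * kd * a + 2 * kd), by positivity, ?_⟩
  intro q η ω y w F h hF hh0 hh1 hb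
  set V := lyap a y w with hV
  have hyV : ‖y‖ ^ 2 ≤ 4 * V := norm_pos_sq_le_lyap ha y w
  have hwV : ‖w‖ ^ 2 ≤ 2 * V := norm_vel_sq_le_lyap a y w
  have hV0 : 0 ≤ V := lyap_nonneg a y w
  -- distribute the damping term `a w = ∑ j, kd w` over the neighbours
  have hsplit : ⟪a • y + w, a • w + accel N kp kd q η ω y w⟫ + ⟪w, accel N kp kd q η ω y w⟫
      = ∑ j ∈ N, (kd * ⟪a • y + w, w⟫
        + ⟪a • y + (2 : ℝ) • w, kp • proj (bearing (q j)) (η j - y) + kd • (ω j - w)⟫) := by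
    rw [Finset.sum_add_distrib, Finset.sum_const, nsmul_eq_mul, ← inner_sum]
    change _ = _ + ⟪a • y + (2 : ℝ) • w, accel N kp kd q η ω y w⟫
    rw [two_smul, ← add_assoc, inner_add_left (a • y + w) w, inner_add_right, real_inner_smul_right,
      ha']
    ring
  have hterm : ∀ j ∈ N, kd * ⟪a • y + w, w⟫
        + ⟪a • y + (2 : ℝ) • w, kp • proj (bearing (q j)) (η j - y) + kd • (ω j - w)⟫
      ≤ -ε * (‖w‖ ^ 2 + ‖proj (bearing (q j)) (y - η j)‖ ^ 2)
        + (3 * kp * a + 2 * kd * a + 2 * kd) * h * (V + F ^ 2) := by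
    intro j hj
    obtain ⟨hη, hω⟩ := hb j hj
    set e := y - η j with he
    set P := proj (bearing (q j)) with hP
    have hye : y = e + η j := by rw [he]; abel
    have e1 : η j - y = -e := by rw [he]; abel
    -- substitute `y = e + η j`, so that `⟪y, π e⟫` yields the dissipated `‖π e‖²`
    have expand : kd * ⟪a • y + w, w⟫ + ⟪a • y + (2 : ℝ) • w, kp • P (η j - y) + kd • (ω j - w)⟫
        = -(kd * ‖w‖ ^ 2) - kp * a * ‖P e‖ ^ 2 - kp * a * ⟪η j, P e⟫ - 2 * kp * ⟪w, P e⟫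
          + kd * (a * ⟪y, ω j⟫ + 2 * ⟪w, ω j⟫) := by
      have e2 : ⟪y, P e⟫ = ‖P e‖ ^ 2 + ⟪η j, P e⟫ := by
        rw [← inner_proj_bearing, ← inner_add_left, ← hye]
      rw [e1, map_neg]
      simp only [inner_add_left, inner_add_right, inner_sub_right, inner_neg_right, smul_neg,
        real_inner_smul_left, real_inner_smul_right, e2, real_inner_self_eq_norm_sq]
      ring
    have hd : ‖P e‖ ≤ ‖y‖ + F := by
      calc ‖P e‖ ≤ ‖e‖ := norm_proj_bearing_le _ _
        _ ≤ ‖y‖ + ‖η j‖ := norm_sub_le _ _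
        _ ≤ ‖y‖ + F := by gcongr; nlinarith
    have c1 : -⟪η j, P e⟫ ≤ F * h * (‖y‖ + F) :=
      (neg_le_abs _).trans ((abs_real_inner_le_norm _ _).trans (by gcongr))
    have c2 : -⟪w, P e⟫ ≤ ‖w‖ * ‖P e‖ := (neg_le_abs _).trans (abs_real_inner_le_norm _ _)
    have c3 : ⟪y, ω j⟫ ≤ ‖y‖ * (F * h) := (real_inner_le_norm _ _).trans (by gcongr)
    have c4 : ⟪w, ω j⟫ ≤ ‖w‖ * (F * h) := (real_inner_le_norm _ _).trans (by gcongr)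
    have f1 : F * ‖y‖ ≤ 2 * (V + F ^ 2) := by nlinarith [sq_nonneg (F - ‖y‖)]
    have f2 : F * ‖w‖ ≤ V + F ^ 2 := by nlinarith [sq_nonneg (F - ‖w‖)]
    have hq := hquad ‖w‖ ‖P e‖
    rw [expand]
    have g1 : kp * a * -⟪η j, P e⟫ ≤ kp * a * (h * (3 * (V + F ^ 2))) := by
      refine mul_le_mul_of_nonneg_left ?_ (mul_pos hkp ha0).le
      refine c1.trans ?_
      calc F * h * (‖y‖ + F) = h * (F * ‖y‖ + F ^ 2) := by ring
        _ ≤ h * (3 * (V + F ^ 2)) := by gcongr; linarith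
    have g2 : kp * -⟪w, P e⟫ ≤ kp * (‖w‖ * ‖P e‖) := mul_le_mul_of_nonneg_left c2 hkp.le
    have g3 : kd * (a * ⟪y, ω j⟫ + 2 * ⟪w, ω j⟫)
        ≤ kd * (a * (h * (2 * (V + F ^ 2))) + 2 * (h * (V + F ^ 2))) := by
      refine mul_le_mul_of_nonneg_left (add_le_add (mul_le_mul_of_nonneg_left ?_ ha0.le)
        (mul_le_mul_of_nonneg_left ?_ zero_le_two)) hkd.le
      · refine c3.trans ?_
        calc ‖y‖ * (F * h) = h * (F * ‖y‖) := by ring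
          _ ≤ _ := by gcongr
      · refine c4.trans ?_
        calc ‖w‖ * (F * h) = h * (F * ‖w‖) := by ring
          _ ≤ _ := by gcongr
    linarith
  rw [hsplit]
  refine (Finset.sum_le_sum hterm).trans (le_of_eq ?_)
  rw [Finset.sum_add_distrib, ← Finset.mul_sum, Finset.sum_const, nsmul_eq_mul, dissipation]
  ring

/-- Persistence of excitation, tested on a vector and written as an integral of scalars. -/
lemma exists_excitation (N : Finset ι) {P : ι → ℝ → E3}
    (hP : ∀ j ∈ N, ContinuousOn (P j) (Set.Ioi 0)) (hP0 : ∀ j ∈ N, ∀ t > 0, P j t ≠ 0)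
    (hPE : IsPE fun t => ∑ j ∈ N, proj (bearing (P j t))) :
    ∃ T > 0, ∃ μ > 0, ∀ t > 0, ∀ x : E3,
      μ * ‖x‖ ^ 2 ≤ ∫ s in t..(t + T), ∑ j ∈ N, ‖proj (bearing (P j s)) x‖ ^ 2 := by
  obtain ⟨T, hT, μ, hμ, h⟩ := hPE
  refine ⟨T, hT, T * μ, by positivity, fun t ht x => ?_⟩
  have hcont : ContinuousOn (fun s => ∑ j ∈ N, proj (bearing (P j s))) (Set.Ioi 0) :=
    continuousOn_finsetSum _ fun j hj => continuousOn_proj_bearing (hP j hj) (hP0 j hj)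
  have hint : IntervalIntegrable (fun s => ∑ j ∈ N, proj (bearing (P j s))) volume t (t + T) := by
    refine (hcont.mono fun s hs => ?_).intervalIntegrable
    rw [Set.uIcc_of_le (by linarith)] at hs
    exact ht.trans_le hs.1
  have h1 := (ContinuousLinearMap.le_def _ _).mp (h t ht)
  have h2 := h1.inner_nonneg_right x
  have h3 : ⟪x, (∫ s in t..(t + T), ∑ j ∈ N, proj (bearing (P j s))) x⟫
      = ∫ s in t..(t + T), ∑ j ∈ N, ‖proj (bearing (P j s)) x‖ ^ 2 := by
    have := ((innerSL ℝ x).comp (ContinuousLinearMap.apply ℝ E3 x)).intervalIntegral_comp_comm hint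
    simp only [ContinuousLinearMap.comp_apply, ContinuousLinearMap.apply_apply,
      innerSL_apply_apply] at this
    rw [← this]
    refine intervalIntegral.integral_congr fun s _ => ?_
    simp only [sum_apply, inner_sum, inner_proj_bearing]
  simp only [sub_apply, smul_apply, ContinuousLinearMap.id_apply,
    inner_sub_right, real_inner_smul_right, real_inner_self_eq_norm_sq, h3] at h2
  rw [← sub_nonneg]
  have h4 := mul_nonneg hT.le h2
  rw [mul_sub, ← mul_assoc T (1 / T), mul_one_div_cancel hT.ne', one_mul] at h4
  linarith

/-- Error dynamics of one agent on `[t₀, ∞)`. Here `P j` are the desired positions of the neighbours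
relative to the agent, `η j` and `ω j` are the position and velocity errors of the neighbours, bounded
by `F e^{-c (t - t₀)}`, and `y` and `w` are the errors of the agent itself. The relative position of
neighbour `j` is `P j - (y - η j)`. -/
structure IsDrivenMotion (N : Finset ι) (kp kd : ℝ) (P : ι → ℝ → E3) (c F t₀ : ℝ)
    (η ω : ι → ℝ → E3) (y w : ℝ → E3) : Prop where
  deriv_pos : ∀ t ≥ t₀, HasDerivWithinAt y (w t) (Set.Ici t₀) t
  deriv_vel : ∀ t ≥ t₀, HasDerivWithinAt w (accel N kp kd (fun j => P j t - (y t - η j t))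
    (fun j => η j t) (fun j => ω j t) (y t) (w t)) (Set.Ici t₀) t
  continuousOn_pos : ∀ j ∈ N, ContinuousOn (η j) (Set.Ici t₀)
  ne_zero : ∀ j ∈ N, ∀ t ≥ t₀, P j t - (y t - η j t) ≠ 0
  nonneg : 0 ≤ F
  bound : ∀ j ∈ N, ∀ t ≥ t₀, ‖η j t‖ ≤ F * Real.exp (-c * (t - t₀)) ∧
    ‖ω j t‖ ≤ F * Real.exp (-c * (t - t₀))

/-- Excitation of a fixed vector `y₀` by the desired bearing `p`, bounded in terms of the actual
bearing `p - (y - η)`. -/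
lemma norm_sq_proj_bearing_le {δ B : ℝ} (hδ : 0 < δ) {p y η y₀ : E3} (hp : δ ≤ ‖p‖)
    (hB : ‖y - η‖ ≤ B) :
    ‖proj (bearing p) y₀‖ ^ 2 ≤ 3 * (1 + B / δ) ^ 2
        * ‖proj (bearing (p - (y - η))) (y - η)‖ ^ 2 + 3 * (‖η‖ ^ 2 + ‖y - y₀‖ ^ 2) := by
  set d := (1 + B / δ) * ‖proj (bearing (p - (y - η))) (y - η)‖ with hd
  have e1 : ‖proj (bearing p) (y - η)‖ ≤ d := norm_proj_bearing_sub_le hδ hp hB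
  have hsplit : y₀ = (y - η) + η - (y - y₀) := by abel
  have e4 : ‖proj (bearing p) y₀‖ ≤ d + ‖η‖ + ‖y - y₀‖ := by
    calc ‖proj (bearing p) y₀‖
        = ‖proj (bearing p) (y - η) + proj (bearing p) η - proj (bearing p) (y - y₀)‖ := by
          rw [← map_add, ← map_sub, ← hsplit]
      _ ≤ ‖proj (bearing p) (y - η)‖ + ‖proj (bearing p) η‖ + ‖proj (bearing p) (y - y₀)‖ :=
          (norm_sub_le _ _).trans (by gcongr; exact norm_add_le _ _)
      _ ≤ _ := by
          gcongr
          · exact norm_proj_bearing_le _ _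
          · exact norm_proj_bearing_le _ _
  have e5 := pow_le_pow_left₀ (norm_nonneg _) e4 2
  have e6 : 3 * (1 + B / δ) ^ 2 * ‖proj (bearing (p - (y - η))) (y - η)‖ ^ 2 = 3 * d ^ 2 := by
    rw [hd]; ring
  rw [e6]
  nlinarith [sq_nonneg (d - ‖η‖), sq_nonneg (d - ‖y - y₀‖), sq_nonneg (‖η‖ - ‖y - y₀‖)]

namespace IsDrivenMotion

variable {N : Finset ι} {kp kd : ℝ} {P : ι → ℝ → E3} {c F t₀ : ℝ} {η ω : ι → ℝ → E3}
  {y w : ℝ → E3}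

lemma continuousOn_y (h : IsDrivenMotion N kp kd P c F t₀ η ω y w) :
    ContinuousOn y (Set.Ici t₀) := fun t ht => (h.deriv_pos t ht).continuousWithinAt

lemma continuousOn_w (h : IsDrivenMotion N kp kd P c F t₀ η ω y w) :
    ContinuousOn w (Set.Ici t₀) := fun t ht => (h.deriv_vel t ht).continuousWithinAt

lemma hasDerivWithinAt_lyap (h : IsDrivenMotion N kp kd P c F t₀ η ω y w) (a : ℝ) :
    ∀ t ≥ t₀, HasDerivWithinAt (fun t => lyap a (y t) (w t))
      (⟪a • y t + w t, a • w t + accel N kp kd (fun j => P j t - (y t - η j t))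
          (fun j => η j t) (fun j => ω j t) (y t) (w t)⟫
        + ⟪w t, accel N kp kd (fun j => P j t - (y t - η j t))
          (fun j => η j t) (fun j => ω j t) (y t) (w t)⟫) (Set.Ici t₀) t :=
  fun t ht => BearingFormation.hasDerivWithinAt_lyap (h.deriv_pos t ht) (h.deriv_vel t ht)

lemma continuousOn_dissipation (h : IsDrivenMotion N kp kd P c F t₀ η ω y w)
    (hP : ∀ j ∈ N, ContinuousOn (P j) (Set.Ioi 0)) (ht₀ : 0 ≤ t₀) :
    ContinuousOn (fun t => dissipation N (fun j => P j t - (y t - η j t)) (fun j => η j t) (y t)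
      (w t)) (Set.Ioi t₀) := by
  have hs : Set.Ioi t₀ ⊆ Set.Ici t₀ := Set.Ioi_subset_Ici_self
  refine continuousOn_finsetSum _ fun j hj => ?_
  have he : ContinuousOn (fun t => y t - η j t) (Set.Ioi t₀) :=
    (h.continuousOn_y.sub (h.continuousOn_pos j hj)).mono hs
  have hq : ContinuousOn (fun t => P j t - (y t - η j t)) (Set.Ioi t₀) :=
    ((hP j hj).mono fun t ht => ht₀.trans_lt ht).sub he
  exact ((h.continuousOn_w.mono hs).norm.pow 2).add
    (((continuousOn_proj_bearing hq fun t ht => h.ne_zero j hj t (hs ht)).clm_apply he).norm.pow 2)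

set_option maxHeartbeats 1000000 in
/-- Excitation along the desired trajectory makes the Lyapunov function contract over a window of
length `T`. The constants depend on the motion only through a bound `B` on the position errors
relative to the neighbours. -/
lemma exists_contraction (hN : N.Nonempty) {ε C L T μ δ B : ℝ} (hε : 0 < ε) (hC : 0 ≤ C)
    (hL : 0 ≤ L) (hT : 0 < T) (hμ : 0 < μ) (hδ : 0 < δ) (hB : 0 ≤ B)
    (hP : ∀ j ∈ N, ContinuousOn (P j) (Set.Ioi 0)) (hPδ : ∀ j ∈ N, ∀ t > 0, δ ≤ ‖P j t‖)
    (hexc : ∀ t > 0, ∀ x : E3,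
      μ * ‖x‖ ^ 2 ≤ ∫ s in t..(t + T), ∑ j ∈ N, ‖proj (bearing (P j s)) x‖ ^ 2)
    (a : ℝ) (hc : 0 < c) :
    ∃ ρ ≥ 0, ρ < 1 ∧ ∃ A ≥ 0, ∀ (F t₀ : ℝ) (η ω : ι → ℝ → E3) (y w : ℝ → E3), 0 ≤ t₀ →
      IsDrivenMotion N kp kd P c F t₀ η ω y w →
      (∀ j ∈ N, ∀ t ≥ t₀, ‖y t - η j t‖ ≤ B) →
      (∀ t ≥ t₀, ⟪a • y t + w t, a • w t + accel N kp kd (fun j => P j t - (y t - η j t))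
            (fun j => η j t) (fun j => ω j t) (y t) (w t)⟫
          + ⟪w t, accel N kp kd (fun j => P j t - (y t - η j t))
            (fun j => η j t) (fun j => ω j t) (y t) (w t)⟫
        ≤ -ε * dissipation N (fun j => P j t - (y t - η j t)) (fun j => η j t) (y t) (w t)
          + C * Real.exp (-c * (t - t₀)) * (L * F ^ 2)) →
      ∀ t > t₀, lyap a (y (t + T)) (w (t + T)) ≤ ρ * lyap a (y t) (w t)
        + A * F ^ 2 * Real.exp (-c * (t - t₀)) := by
  set κ := 1 + B / δ with hκ
  have hκ0 : 0 < κ := by positivity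
  set m := (N.card : ℝ) with hm
  have hm0 : 0 ≤ m := Nat.cast_nonneg _
  set A₁ := 2 * a ^ 2 * T / μ * (3 * κ ^ 2 + 3 * m * T ^ 2) + 2 * a ^ 2 * T ^ 2 + 2 with hA₁
  set A₂ := 2 * a ^ 2 * T / μ * (3 * m * T) + C * L * T ^ 2 with hA₂
  have hA₁0 : 0 < A₁ := by positivity
  have hA₂0 : 0 ≤ A₂ := by positivity
  have hs : 0 < A₁ + ε * T := by positivity
  refine ⟨A₁ / (A₁ + ε * T), by positivity, ?_, (A₁ * (C * L * T) + ε * A₂) / (A₁ + ε * T),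
    by positivity, ?_⟩
  · rw [div_lt_one hs]
    linarith [mul_pos hε hT]
  intro F t₀ η ω y w ht₀ hmot hbd hdiss t ht
  set h := Real.exp (-c * (t - t₀)) with hh
  have hh0 : 0 < h := Real.exp_pos _
  set D : ℝ → ℝ := fun s => dissipation N (fun j => P j s - (y s - η j s)) (fun j => η j s) (y s)
    (w s) with hD
  set V : ℝ → ℝ := fun s => lyap a (y s) (w s) with hV
  have htT : t ≤ t + T := by linarith
  have hsub : Set.Icc t (t + T) ⊆ Set.Ioi t₀ := fun s hs => ht.trans_le hs.1
  have hsub' : Set.Icc t (t + T) ⊆ Set.Ici t₀ := hsub.trans Set.Ioi_subset_Ici_self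
  have hDc : ContinuousOn D (Set.Icc t (t + T)) := (hmot.continuousOn_dissipation hP ht₀).mono hsub
  have hyc := hmot.continuousOn_y.mono hsub'
  have hwc := hmot.continuousOn_w.mono hsub'
  have hVder := hmot.hasDerivWithinAt_lyap a
  have hVc : ContinuousOn V (Set.Icc t (t + T)) :=
    fun s hs => ((hVder s (hsub' hs)).mono hsub').continuousWithinAt
  have hDw : ∀ s, ‖w s‖ ^ 2 ≤ D s := by
    intro s
    obtain ⟨j, hj⟩ := hN
    calc ‖w s‖ ^ 2 ≤ ‖w s‖ ^ 2 + ‖proj (bearing (P j s - (y s - η j s))) (y s - η j s)‖ ^ 2 := by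
          linarith [sq_nonneg ‖proj (bearing (P j s - (y s - η j s))) (y s - η j s)‖]
      _ ≤ D s := Finset.single_le_sum
          (f := fun j => ‖w s‖ ^ 2 + ‖proj (bearing (P j s - (y s - η j s))) (y s - η j s)‖ ^ 2)
          (fun j _ => by positivity) hj
  have hDnn : ∀ s, 0 ≤ D s := fun s => (sq_nonneg _).trans (hDw s)
  have hu : Set.uIcc t (t + T) = Set.Icc t (t + T) := Set.uIcc_of_le htT
  have iD : IntervalIntegrable D volume t (t + T) := ContinuousOn.intervalIntegrable (hu ▸ hDc)
  have iw : IntervalIntegrable (fun s => ‖w s‖ ^ 2) volume t (t + T) :=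
    ContinuousOn.intervalIntegrable (hu ▸ hwc.norm.pow 2)
  set I := ∫ s in t..(t + T), D s with hI
  have hI0 : 0 ≤ I := intervalIntegral.integral_nonneg htT fun s _ => hDnn s
  have hwI : ∫ s in t..(t + T), ‖w s‖ ^ 2 ≤ I :=
    intervalIntegral.integral_mono_on htT iw iD fun s _ => hDw s
  have hexp : ∀ s ≥ t, Real.exp (-c * (s - t₀)) ≤ h := fun s hs =>
    Real.exp_le_exp.mpr (by nlinarith)
  have hVle : ∀ τ ∈ Set.Icc t (t + T), V (t + T) - V τ
      ≤ ∫ s in τ..(t + T), (-ε * D s + C * h * (L * F ^ 2)) := by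
    intro τ hτ
    have hsτ : Set.Icc τ (t + T) ⊆ Set.Icc t (t + T) := Set.Icc_subset_Icc_left hτ.1
    refine intervalIntegral.sub_le_integral_of_hasDeriv_right_of_le hτ.2 (hVc.mono hsτ)
      (fun s hs => (hVder s (hsub' (hsτ (Set.Ioo_subset_Icc_self hs)))).mono
        fun x hx => ?_) ?_ fun s hs => ?_
    · exact (Set.mem_Ici.mp (hsub' (hsτ (Set.Ioo_subset_Icc_self hs)))).trans
          (Set.mem_Ioi.mp hx).le
    · exact ((continuousOn_const.mul (hDc.mono hsτ)).add continuousOn_const).integrableOn_Icc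
    · have hst : t ≤ s := hτ.1.trans hs.1.le
      refine (hdiss s (ht.le.trans hst)).trans ?_
      gcongr
      exact hexp s hst
  -- decrease over the whole window
  have est1 : V (t + T) - V t ≤ -ε * I + C * h * (L * F ^ 2) * T := by
    refine (hVle t ⟨le_rfl, htT⟩).trans (le_of_eq ?_)
    rw [intervalIntegral.integral_add (iD.const_mul _) (by simp),
      intervalIntegral.integral_const_mul, intervalIntegral.integral_const, smul_eq_mul]
    ring
  -- near monotonicity inside the window
  have est2 : ∀ τ ∈ Set.Icc t (t + T), V (t + T) ≤ V τ + C * h * (L * F ^ 2) * T := by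
    intro τ hτ
    have hsτ : Set.Icc τ (t + T) ⊆ Set.Icc t (t + T) := Set.Icc_subset_Icc_left hτ.1
    have hcst : 0 ≤ C * h * (L * F ^ 2) := by positivity
    have h1 : ∫ s in τ..(t + T), (-ε * D s + C * h * (L * F ^ 2))
        ≤ ∫ _s in τ..(t + T), C * h * (L * F ^ 2) := by
      refine intervalIntegral.integral_mono_on hτ.2 (ContinuousOn.intervalIntegrable ?_) (by simp)
        fun s _ => ?_
      · rw [Set.uIcc_of_le hτ.2]
        exact (continuousOn_const.mul (hDc.mono hsτ)).add continuousOn_const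
      · linarith [mul_nonneg hε.le (hDnn s)]
    rw [intervalIntegral.integral_const, smul_eq_mul] at h1
    have h2 : (t + T - τ) * (C * h * (L * F ^ 2)) ≤ T * (C * h * (L * F ^ 2)) := by
      gcongr
      linarith [hτ.1]
    linarith [hVle τ hτ]
  -- the position error moves little when the dissipation is small
  have est3 : ∀ τ ∈ Set.Icc t (t + T), ‖y τ - y t‖ ^ 2 ≤ T * I := by
    intro τ hτ
    have hsτ : Set.Icc t τ ⊆ Set.Icc t (t + T) := Set.Icc_subset_Icc_right hτ.2
    have hint : ∫ s in t..τ, w s = y τ - y t := by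
      refine intervalIntegral.integral_eq_sub_of_hasDeriv_right_of_le hτ.1 (hyc.mono hsτ)
        (fun s hs => (hmot.deriv_pos s (hsub' (hsτ (Set.Ioo_subset_Icc_self hs)))).mono
          fun x hx => ?_) (ContinuousOn.intervalIntegrable ?_)
      · exact (Set.mem_Ici.mp (hsub' (hsτ (Set.Ioo_subset_Icc_self hs)))).trans
          (Set.mem_Ioi.mp hx).le
      · rw [Set.uIcc_of_le hτ.1]
        exact hwc.mono hsτ
    calc ‖y τ - y t‖ ^ 2 ≤ (∫ s in t..τ, ‖w s‖) ^ 2 := by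
          rw [← hint]
          gcongr
          exact intervalIntegral.norm_integral_le_integral_norm hτ.1
      _ ≤ (τ - t) * ∫ s in t..τ, ‖w s‖ ^ 2 := sq_integral_le hτ.1 (hwc.mono hsτ).norm
      _ ≤ T * ∫ s in t..(t + T), ‖w s‖ ^ 2 := by
          refine mul_le_mul (by linarith [hτ.2]) ?_
            (intervalIntegral.integral_nonneg hτ.1 fun s _ => sq_nonneg _) hT.le
          exact intervalIntegral.integral_mono_interval le_rfl hτ.1 hτ.2
            (Filter.Eventually.of_forall fun s => sq_nonneg _) iw
      _ ≤ T * I := by gcongr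
  -- excitation bounds the position error by the dissipation
  have est4 : μ * ‖y t‖ ^ 2 ≤ 3 * κ ^ 2 * I + 3 * m * T * (F ^ 2 * h + T * I) := by
    refine (hexc t (ht₀.trans_lt ht) (y t)).trans ?_
    have hpt : ∀ s ∈ Set.Icc t (t + T), ∑ j ∈ N, ‖proj (bearing (P j s)) (y t)‖ ^ 2
        ≤ 3 * κ ^ 2 * D s + 3 * m * (F ^ 2 * h + T * I) := by
      intro s hs
      have hs0 : 0 < s := ht₀.trans_lt (hsub hs)
      have hterm : ∀ j ∈ N, ‖proj (bearing (P j s)) (y t)‖ ^ 2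
          ≤ 3 * κ ^ 2 * (‖w s‖ ^ 2
              + ‖proj (bearing (P j s - (y s - η j s))) (y s - η j s)‖ ^ 2)
            + 3 * (F ^ 2 * h + T * I) := by
        intro j hj
        have e2 : ‖η j s‖ ^ 2 ≤ F ^ 2 * h := by
          have h1 := (hmot.bound j hj s (hsub' hs)).1
          have h2 := hexp s hs.1
          have h3 : Real.exp (-c * (s - t₀)) ≤ 1 := Real.exp_le_one_iff.mpr (by
            have : t₀ ≤ s := hsub' hs
            nlinarith)
          calc ‖η j s‖ ^ 2 ≤ (F * Real.exp (-c * (s - t₀))) ^ 2 := by gcongr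
            _ = F ^ 2 * (Real.exp (-c * (s - t₀)) * Real.exp (-c * (s - t₀))) := by ring
            _ ≤ F ^ 2 * (h * 1) := by gcongr
            _ = _ := by ring
        have e3 := norm_sq_proj_bearing_le (y₀ := y t) hδ (hPδ j hj s hs0)
          (hbd j hj s (hsub' hs))
        have e4 : 0 ≤ 3 * κ ^ 2 * ‖w s‖ ^ 2 := by positivity
        linarith [est3 s hs]
      refine (Finset.sum_le_sum hterm).trans (le_of_eq ?_)
      rw [Finset.sum_add_distrib, ← Finset.mul_sum, Finset.sum_const, nsmul_eq_mul, ← hm]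
      simp only [hD, dissipation]
      ring
    have hPc : ContinuousOn (fun s => ∑ j ∈ N, ‖proj (bearing (P j s)) (y t)‖ ^ 2)
        (Set.Icc t (t + T)) := by
      have hsub0 : Set.Icc t (t + T) ⊆ Set.Ioi 0 := fun s hs => ht₀.trans_lt (hsub hs)
      refine continuousOn_finsetSum _ fun j hj => ?_
      exact ((continuousOn_proj_bearing ((hP j hj).mono hsub0) fun s hs =>
        norm_pos_iff.mp (hδ.trans_le (hPδ j hj s (hsub0 hs)))).clm_apply
          continuousOn_const).norm.pow 2
    refine (intervalIntegral.integral_mono_on htT (ContinuousOn.intervalIntegrable (hu ▸ hPc))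
      ((iD.const_mul _).add (by simp)) hpt).trans (le_of_eq ?_)
    rw [intervalIntegral.integral_add (iD.const_mul _) (by simp),
      intervalIntegral.integral_const_mul, intervalIntegral.integral_const, smul_eq_mul]
    ring
  -- average the Lyapunov function over the window
  have est5 : T * V (t + T) ≤ 2 * a ^ 2 * T * ‖y t‖ ^ 2 + 2 * a ^ 2 * T ^ 2 * I + 2 * I
      + C * h * (L * F ^ 2) * T ^ 2 := by
    have hpt : ∀ s ∈ Set.Icc t (t + T), V (t + T) ≤ 2 * ‖w s‖ ^ 2
        + (2 * a ^ 2 * ‖y t‖ ^ 2 + 2 * a ^ 2 * (T * I) + C * h * (L * F ^ 2) * T) := by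
      intro s hs
      have e1 : ‖y s‖ ≤ ‖y t‖ + ‖y s - y t‖ := by
        calc ‖y s‖ = ‖y t + (y s - y t)‖ := by rw [add_sub_cancel]
          _ ≤ _ := norm_add_le _ _
      have e2 : ‖y s‖ ^ 2 ≤ 2 * ‖y t‖ ^ 2 + 2 * (T * I) := by
        have := pow_le_pow_left₀ (norm_nonneg _) e1 2
        linarith [est3 s hs, sq_nonneg (‖y t‖ - ‖y s - y t‖)]
      have e3 : a ^ 2 * ‖y s‖ ^ 2 ≤ a ^ 2 * (2 * ‖y t‖ ^ 2 + 2 * (T * I)) := by gcongr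
      linarith [est2 s hs, lyap_le a (y s) (w s)]
    have h1 := intervalIntegral.integral_mono_on htT (by simp)
      ((iw.const_mul 2).add (by simp)) hpt
    rw [intervalIntegral.integral_add (iw.const_mul _) (by simp),
      intervalIntegral.integral_const_mul, intervalIntegral.integral_const,
      intervalIntegral.integral_const, smul_eq_mul, smul_eq_mul, add_sub_cancel_left] at h1
    linarith
  have est6 : T * V (t + T) ≤ A₁ * I + A₂ * (F ^ 2 * h) := by
    have h1 : 2 * a ^ 2 * T * ‖y t‖ ^ 2 = 2 * a ^ 2 * T / μ * (μ * ‖y t‖ ^ 2) := by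
      field_simp
    have h2 : 2 * a ^ 2 * T / μ * (μ * ‖y t‖ ^ 2)
        ≤ 2 * a ^ 2 * T / μ * (3 * κ ^ 2 * I + 3 * m * T * (F ^ 2 * h + T * I)) := by gcongr
    rw [hA₁, hA₂]
    linarith
  have est7 : (A₁ + ε * T) * V (t + T)
      ≤ A₁ * V t + (A₁ * (C * L * T) + ε * A₂) * (F ^ 2 * h) := by
    have h1 := mul_le_mul_of_nonneg_left est1 hA₁0.le
    have h2 := mul_le_mul_of_nonneg_left est6 hε.le
    linarith
  have hquot : A₁ / (A₁ + ε * T) * V t + (A₁ * (C * L * T) + ε * A₂) / (A₁ + ε * T) * F ^ 2 * h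
      = (A₁ * V t + (A₁ * (C * L * T) + ε * A₂) * (F ^ 2 * h)) / (A₁ + ε * T) := by ring
  change V (t + T) ≤ A₁ / (A₁ + ε * T) * V t + _
  rw [hquot, le_div_iff₀ hs]
  linarith

end IsDrivenMotion

set_option maxHeartbeats 1000000 in
/-- Exponential decay of the errors of an agent driven by neighbours with exponentially decaying
errors, uniformly over all motions with initial errors at most `R` and homogeneously in the size `F`
of the data. -/
theorem exists_decay_of_driven {N : Finset ι} {kp kd : ℝ} {P : ι → ℝ → E3} (hN : N.Nonempty)
    (hkp : 0 < kp) (hkd : 0 < kd) (ha : 1 ≤ kd * N.card) (hgain : kp < kd ^ 2 * N.card)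
    (hP : ∀ j ∈ N, ContinuousOn (P j) (Set.Ioi 0)) {δ : ℝ} (hδ : 0 < δ)
    (hPδ : ∀ j ∈ N, ∀ t > 0, δ ≤ ‖P j t‖)
    (hPE : IsPE fun t => ∑ j ∈ N, proj (bearing (P j t))) {c R : ℝ} (hc : 0 < c) (hR : 0 ≤ R) :
    ∃ K > 0, ∃ c' > 0, ∀ (F t₀ : ℝ) (η ω : ι → ℝ → E3) (y w : ℝ → E3), 0 ≤ t₀ → F ≤ R →
      IsDrivenMotion N kp kd P c F t₀ η ω y w → ‖y t₀‖ ≤ F → ‖w t₀‖ ≤ F →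
      ∀ t ≥ t₀, ‖y t‖ ≤ K * F * Real.exp (-c' * (t - t₀)) ∧
        ‖w t‖ ≤ K * F * Real.exp (-c' * (t - t₀)) := by
  obtain ⟨T, hT, μ, hμ, hexc⟩ := exists_excitation N hP
    (fun j hj t ht => norm_pos_iff.mp (hδ.trans_le (hPδ j hj t ht))) hPE
  obtain ⟨ε, hε, C, hC, hdiss⟩ := exists_lyap_deriv_le N hkp hkd ha hgain
  set a : ℝ := kd * N.card with ha'
  -- `V + F ^ 2` starts below `(a ^ 2 + 3) F ^ 2` and grows at most by the Grönwall factor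
  set L := Real.exp (C / c) * (a ^ 2 + 3) with hL
  have hL0 : 0 < L := by positivity
  obtain ⟨ρ, hρ0, hρ1, A, hA, hcontr⟩ := IsDrivenMotion.exists_contraction (kp := kp) (kd := kd) hN
    hε hC hL0.le hT hμ hδ (B := (2 * √L + 1) * R) (by positivity) hP hPδ hexc a hc
  obtain ⟨K, hK, c', hc', hdecay⟩ := exists_exp_decay_of_contraction hT hρ0 hρ1 hc
  set S := 4 * (K * (L + A)) with hS
  have hS0 : 0 < S := by positivity
  refine ⟨1 + S, by positivity, c' / 2, by positivity, ?_⟩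
  intro F t₀ η ω y w ht₀ hFR hmot hy0 hw0
  have hF := hmot.nonneg
  set V : ℝ → ℝ := fun s => lyap a (y s) (w s) with hV
  have hder := hmot.hasDerivWithinAt_lyap a
  have hexp1 : ∀ s ≥ t₀, Real.exp (-c * (s - t₀)) ≤ 1 := fun s hs =>
    Real.exp_le_one_iff.mpr (by nlinarith)
  have hd := fun s (hs : s ≥ t₀) => hdiss (fun j => P j s - (y s - η j s)) (fun j => η j s)
    (fun j => ω j s) (y s) (w s) F (Real.exp (-c * (s - t₀))) hF (Real.exp_pos _).le (hexp1 s hs)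
    (fun j hj => hmot.bound j hj s hs)
  have hVL : ∀ s ≥ t₀, V s + F ^ 2 ≤ L * F ^ 2 := by
    intro s hs
    refine (le_mul_exp_of_deriv_le hc hC (fun s hs => (hder s hs).add_const (F ^ 2))
      (fun s _ => add_nonneg (lyap_nonneg _ _ _) (sq_nonneg F)) (fun s hs => (hd s hs).trans ?_)
      s hs).trans ?_
    · have : 0 ≤ ε * dissipation N (fun j => P j s - (y s - η j s)) (fun j => η j s) (y s) (w s) :=
        mul_nonneg hε.le (Finset.sum_nonneg fun j _ => by positivity)
      linarith
    · have h1 := lyap_le a (y t₀) (w t₀)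
      have h2 : a ^ 2 * ‖y t₀‖ ^ 2 + 2 * ‖w t₀‖ ^ 2 ≤ a ^ 2 * F ^ 2 + 2 * F ^ 2 := by gcongr
      rw [hL, mul_assoc]
      gcongr
      linarith
  have hbd : ∀ j ∈ N, ∀ s ≥ t₀, ‖y s - η j s‖ ≤ (2 * √L + 1) * R := by
    intro j hj s hs
    have h1 : ‖y s‖ ≤ 2 * √L * F := by
      refine le_of_sq_le_sq ?_ (by positivity)
      have h4 := norm_pos_sq_le_lyap ha (y s) (w s)
      rw [mul_pow, mul_pow, Real.sq_sqrt hL0.le]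
      have := hVL s hs
      simp only [hV] at this
      linarith [sq_nonneg F]
    have h2 : ‖η j s‖ ≤ F := (hmot.bound j hj s hs).1.trans
      (mul_le_of_le_one_right hF (hexp1 s hs))
    calc ‖y s - η j s‖ ≤ ‖y s‖ + ‖η j s‖ := norm_sub_le _ _
      _ ≤ (2 * √L + 1) * F := by linarith
      _ ≤ _ := by gcongr
  have hmain := hcontr F t₀ η ω y w ht₀ hmot hbd fun s hs => (hd s hs).trans (by
    gcongr
    exact hVL s hs)
  have hVd := hdecay t₀ ((L + A) * F ^ 2) V (by positivity)
    (fun s hs => by nlinarith [hVL s hs, sq_nonneg F, mul_nonneg hA (sq_nonneg F)])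
    (fun s hs => (hmain s hs).trans (by
      gcongr
      linarith))
  intro t ht
  -- the errors are of the order of the square root of `V`, hence decay with half its rate
  set E := Real.exp (-(c' / 2) * (t - t₀)) with hE
  have hE2 : Real.exp (-c' * (t - t₀)) = E ^ 2 := by
    rw [hE, ← Real.exp_nat_mul]
    congr 1
    push_cast
    ring
  have hVt := hVd t ht
  rw [hE2] at hVt
  have hV4 : 4 * V t ≤ ((1 + S) * F * E) ^ 2 := by
    have h1 : S * (F * E) ^ 2 ≤ (1 + S) ^ 2 * (F * E) ^ 2 := by
      gcongr
      nlinarith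
    calc 4 * V t ≤ S * (F * E) ^ 2 := by rw [hS]; linarith
      _ ≤ _ := h1
      _ = _ := by ring
  have hnn : 0 ≤ (1 + S) * F * E := by positivity
  constructor
  · exact le_of_sq_le_sq ((norm_pos_sq_le_lyap ha (y t) (w t)).trans hV4) hnn
  · refine le_of_sq_le_sq ((norm_vel_sq_le_lyap a (y t) (w t)).trans (le_trans ?_ hV4)) hnn
    have := lyap_nonneg a (y t) (w t)
    simp only [hV]
    linarith

/-! ### Leader-follower digraphs -/

lemma reflTransGen_of_isChain {V : Type*} {G : Digraph V} {b : V} :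
    ∀ (l : List V) (a : V), l.IsChain G.Adj → l.head? = some a → l.getLast? = some b →
      Relation.ReflTransGen G.Adj a b := by
  intro l
  induction l with
  | nil => intro a _ h; simp at h
  | cons x l ih =>
    intro a hc hh hl
    obtain rfl : x = a := by simpa using hh
    cases l with
    | nil =>
      obtain rfl : x = b := by simpa using hl
      exact .refl
    | cons z l =>
      rw [List.isChain_cons_cons] at hc
      exact .head hc.1 (ih z hc.2 rfl (by simpa using hl))

lemma IsLeaderFollower.reflTransGen {V : Type*} {G : Digraph V} {r : V}
    (hG : IsLeaderFollower G r) (a : V) : Relation.ReflTransGen G.Adj a r := by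
  obtain ⟨-, T, hT, -, hpath⟩ := hG
  rcases eq_or_ne a r with rfl | ha
  · exact .refl
  · obtain ⟨l, ⟨-, hc, hh, hl⟩, -⟩ := hpath a ha
    exact reflTransGen_of_isChain l a (hc.imp fun _ _ h => hT h) hh hl

lemma IsLeaderFollower.not_adj {V : Type*} {G : Digraph V} {r : V}
    (hG : IsLeaderFollower G r) (j : V) : ¬ G.Adj r j := fun h =>
  hG.1 r (.head' h (hG.reflTransGen j))

lemma IsAcyclicDigraph.wellFounded {V : Type*} [Finite V] {G : Digraph V}
    (hG : IsAcyclicDigraph G) : WellFounded fun j i => G.Adj i j := by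
  have : IsTrans V fun j i => Relation.TransGen G.Adj i j := ⟨fun _ _ _ h h' => h'.trans h⟩
  have : Std.Irrefl fun j i => Relation.TransGen G.Adj i j := ⟨hG⟩
  exact Subrelation.wf (r := fun j i => Relation.TransGen G.Adj i j) (fun h => .single h)
    (Finite.wellFounded_of_trans_of_irrefl _)

variable {n : ℕ} {G : Digraph (Fin n)}

lemma mem_nbrs {i j : Fin n} : j ∈ nbrs G i ↔ G.Adj i j := by simp [nbrs]

lemma mem_reach {i k : Fin n} : k ∈ reach G i ↔ Relation.ReflTransGen G.Adj i k := by simp [reach]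

lemma IsLeaderFollower.nbrs_nonempty {r : Fin n} (hG : IsLeaderFollower G r) {i : Fin n}
    (hi : i ≠ r) : (nbrs G i).Nonempty := by
  rcases (hG.reflTransGen i).cases_head with h | ⟨j, h, -⟩
  · exact absurd h hi
  · exact ⟨j, mem_nbrs.mpr h⟩

lemma IsLeaderFollower.nbrs_leader {r : Fin n} (hG : IsLeaderFollower G r) : nbrs G r = ∅ :=
  Finset.eq_empty_of_forall_notMem fun j hj => hG.not_adj j (mem_nbrs.mp hj)

/-! ### Error norms -/

lemma norm_relError_sq (pd vd p v : Fin n → ℝ → E3) (i j : Fin n) (t : ℝ) :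
    ‖relError pd vd p v i j t‖ ^ 2
      = ‖rel p i j t - rel pd i j t‖ ^ 2 + ‖rel v i j t - rel vd i j t‖ ^ 2 := by
  rw [WithLp.prod_norm_sq_eq_of_L2]
  rfl

lemma norm_pos_le_relError (pd vd p v : Fin n → ℝ → E3) (i j : Fin n) (t : ℝ) :
    ‖rel p i j t - rel pd i j t‖ ≤ ‖relError pd vd p v i j t‖ :=
  le_of_sq_le_sq (by rw [norm_relError_sq]; linarith [sq_nonneg ‖rel v i j t - rel vd i j t‖])
    (norm_nonneg _)

lemma norm_vel_le_relError (pd vd p v : Fin n → ℝ → E3) (i j : Fin n) (t : ℝ) :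
    ‖rel v i j t - rel vd i j t‖ ≤ ‖relError pd vd p v i j t‖ :=
  le_of_sq_le_sq (by rw [norm_relError_sq]; linarith [sq_nonneg ‖rel p i j t - rel pd i j t‖])
    (norm_nonneg _)

lemma norm_relError_le (pd vd p v : Fin n → ℝ → E3) (i j : Fin n) (t : ℝ) :
    ‖relError pd vd p v i j t‖
      ≤ ‖rel p i j t - rel pd i j t‖ + ‖rel v i j t - rel vd i j t‖ := by
  refine le_of_sq_le_sq ?_ (by positivity)
  rw [norm_relError_sq]
  nlinarith [mul_nonneg (norm_nonneg (rel p i j t - rel pd i j t))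
    (norm_nonneg (rel v i j t - rel vd i j t))]

lemma relError_le_cascadeErrorNorm (pd vd p v : Fin n → ℝ → E3) {i j : Fin n} (hij : G.Adj i j)
    (t : ℝ) : ‖relError pd vd p v i j t‖ ≤ cascadeErrorNorm G pd vd p v i t := by
  refine Real.le_sqrt_of_sq_le ?_
  calc ‖relError pd vd p v i j t‖ ^ 2
      ≤ ∑ l ∈ nbrs G i, ‖relError pd vd p v i l t‖ ^ 2 :=
        Finset.single_le_sum (f := fun l => ‖relError pd vd p v i l t‖ ^ 2)
          (fun l _ => sq_nonneg _) (mem_nbrs.mpr hij)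
    _ ≤ _ := Finset.single_le_sum (f := fun k => ∑ l ∈ nbrs G k, ‖relError pd vd p v k l t‖ ^ 2)
          (fun k _ => Finset.sum_nonneg fun l _ => sq_nonneg _) (mem_reach.mpr .refl)

lemma cascadeErrorNorm_le_of_adj (pd vd p v : Fin n → ℝ → E3) {i j : Fin n} (hij : G.Adj i j)
    (t : ℝ) : cascadeErrorNorm G pd vd p v j t ≤ cascadeErrorNorm G pd vd p v i t := by
  refine Real.sqrt_le_sqrt (Finset.sum_le_sum_of_subset_of_nonneg (fun k hk => ?_)
    fun k _ _ => Finset.sum_nonneg fun l _ => sq_nonneg _)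
  exact mem_reach.mpr (.head hij (mem_reach.mp hk))

lemma cascadeErrorNorm_nonneg (pd vd p v : Fin n → ℝ → E3) (i : Fin n) (t : ℝ) :
    0 ≤ cascadeErrorNorm G pd vd p v i t := Real.sqrt_nonneg _

/-! ### Error dynamics of the closed loop -/

lemma IsDoubleIntegrator.continuousOn_pos {t₀ : ℝ} {p v u : ℝ → E3}
    (h : IsDoubleIntegrator t₀ p v u) : ContinuousOn p (Set.Ici t₀) :=
  fun t ht => (h t ht).1.continuousWithinAt

lemma IsDoubleIntegrator.continuousOn_vel {t₀ : ℝ} {p v u : ℝ → E3}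
    (h : IsDoubleIntegrator t₀ p v u) : ContinuousOn v (Set.Ici t₀) := by
  intro t ht
  have ht' : t₀ ≤ t + 1 := by linarith [Set.mem_Ici.mp ht]
  have hint := (h (t + 1) ht').2.1
  have hcont : ContinuousOn v (Set.Icc t₀ (t + 1)) := by
    have h1 : ContinuousOn (fun x => v t₀ + ∫ s in t₀..x, u s) (Set.Icc t₀ (t + 1)) := by
      refine continuousOn_const.add ?_
      rw [← Set.uIcc_of_le ht']
      exact intervalIntegral.continuousOn_primitive_interval' hint Set.left_mem_uIcc
    exact h1.congr fun x hx => (h x hx.1).2.2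
  have hmem : Set.Icc t₀ (t + 1) ∈ nhdsWithin t (Set.Ici t₀) := by
    rw [← Set.Ici_inter_Iic]
    exact Filter.inter_mem self_mem_nhdsWithin
      (mem_nhdsWithin_of_mem_nhds (Iic_mem_nhds (by linarith)))
  exact (hcont t ⟨ht, by linarith⟩).mono_of_mem_nhdsWithin hmem

/-- If the accelerations of two double integrators differ by a continuous function, this function is
the derivative of the difference of the velocities. -/
lemma IsDoubleIntegrator.hasDerivWithinAt_vel_sub {t₀ : ℝ} (ht₀ : 0 ≤ t₀)
    {p v u pd vd ud f : ℝ → E3}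
    (h : IsDoubleIntegrator t₀ p v u) (hd : IsDoubleIntegrator 0 pd vd ud)
    (hf : ContinuousOn f (Set.Ici t₀)) (hu : ∀ t ≥ t₀, u t = f t + ud t) :
    ∀ t ≥ t₀, HasDerivWithinAt (fun t => v t - vd t) (f t) (Set.Ici t₀) t := by
  -- only the difference `f` of the accelerations is continuous, `u` and `ud` are just integrable
  have hrep : ∀ t ≥ t₀, v t - vd t = v t₀ - vd t₀ + ∫ s in t₀..t, f s := by
    intro t ht
    have hi0 := (hd t₀ ht₀).2.1
    have hi1 := (hd t (ht₀.trans ht)).2.1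
    have e1 : ∫ s in t₀..t, u s = ∫ s in t₀..t, f s + ud s :=
      intervalIntegral.integral_congr fun s hs => hu s (by
        rw [Set.uIcc_of_le ht] at hs; exact hs.1)
    have hfi : IntervalIntegrable f volume t₀ t := by
      refine (hf.mono fun s hs => ?_).intervalIntegrable
      rw [Set.uIcc_of_le ht] at hs
      exact hs.1
    rw [intervalIntegral.integral_add hfi (hi0.symm.trans hi1)] at e1
    rw [(h t ht).2.2, e1, (hd t (ht₀.trans ht)).2.2, (hd t₀ ht₀).2.2,
      ← intervalIntegral.integral_add_adjacent_intervals hi0 (hi0.symm.trans hi1)]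
    abel
  -- a continuous extension of `f` to the whole line
  have hg : Continuous fun s => f (max t₀ s) :=
    hf.comp_continuous (by fun_prop) fun s => Set.mem_Ici.mpr (le_max_left _ _)
  intro t ht
  have h1 := (hg.integral_hasStrictDerivAt t₀ t).hasDerivAt.const_add (v t₀ - vd t₀)
  rw [max_eq_right ht] at h1
  refine h1.hasDerivWithinAt.congr_of_mem (fun x hx => ?_) ht
  rw [hrep x hx]
  congr 1
  refine intervalIntegral.integral_congr fun s hs => ?_
  rw [Set.uIcc_of_le hx] at hs
  simp only [max_eq_right hs.1]

/-- Tracking error of agent `i` relative to the tracking error of the leader `r`. The leader need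
not track its own desired trajectory, only relative errors decay. -/
def leaderError (r : Fin n) (qd q : Fin n → ℝ → E3) (i : Fin n) (t : ℝ) : E3 :=
  (q i t - qd i t) - (q r t - qd r t)

lemma rel_sub_rel (r : Fin n) (qd q : Fin n → ℝ → E3) (i j : Fin n) (t : ℝ) :
    rel q i j t - rel qd i j t = leaderError r qd q j t - leaderError r qd q i t := by
  simp only [rel, leaderError]
  abel

lemma rel_eq (r : Fin n) (qd q : Fin n → ℝ → E3) (i j : Fin n) (t : ℝ) :
    rel qd i j t - (leaderError r qd q i t - leaderError r qd q j t) = rel q i j t := by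
  simp only [rel, leaderError]
  abel

variable {r : Fin n} {kp kd : Fin n → ℝ} {pd vd ud p v : Fin n → ℝ → E3} {t₀ : ℝ}

lemma IsClosedLoopSolution.hasDerivWithinAt_pos (ht₀ : 0 ≤ t₀)
    (hd : ∀ i, IsDoubleIntegrator 0 (pd i) (vd i) (ud i))
    (h : IsClosedLoopSolution G kp kd pd vd ud t₀ p v) (i : Fin n) :
    ∀ t ≥ t₀, HasDerivWithinAt (leaderError r pd p i) (leaderError r vd v i t) (Set.Ici t₀) t := by
  intro t ht
  have hsub : Set.Ici t₀ ⊆ Set.Ici 0 := Set.Ici_subset_Ici.mpr ht₀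
  have key : ∀ k, HasDerivWithinAt (fun t => p k t - pd k t) (v k t - vd k t) (Set.Ici t₀) t :=
    fun k => (h.1 k t ht).1.sub ((hd k t (ht₀.trans ht)).1.mono hsub)
  exact (key i).sub (key r)

/-- The desired relative position in the control law can be replaced by the position error, since
the projection kills the actual relative position. -/
lemma control_eq (i : Fin n) (t : ℝ) :
    control G kp kd pd vd ud p v i t
      = accel (nbrs G i) (kp i) (kd i)
        (fun j => rel pd i j t - (leaderError r pd p i t - leaderError r pd p j t))
        (fun j => leaderError r pd p j t) (fun j => leaderError r vd v j t)
        (leaderError r pd p i t) (leaderError r vd v i t) + ud i t := by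
  unfold control accel
  congr 1
  refine Finset.sum_congr rfl fun j _ => ?_
  beta_reduce
  rw [rel_eq, ← rel_sub_rel, ← rel_sub_rel, map_sub, proj_bearing_apply_self, zero_sub, smul_neg]

lemma IsClosedLoopSolution.hasDerivWithinAt_vel (hG : IsLeaderFollower G r) (ht₀ : 0 ≤ t₀)
    (hd : ∀ i, IsDoubleIntegrator 0 (pd i) (vd i) (ud i))
    (h : IsClosedLoopSolution G kp kd pd vd ud t₀ p v) (i : Fin n) :
    ∀ t ≥ t₀, HasDerivWithinAt (leaderError r vd v i) (accel (nbrs G i) (kp i) (kd i)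
        (fun j => rel pd i j t - (leaderError r pd p i t - leaderError r pd p j t))
        (fun j => leaderError r pd p j t) (fun j => leaderError r vd v j t)
        (leaderError r pd p i t) (leaderError r vd v i t)) (Set.Ici t₀) t := by
  have hsub : Set.Ici t₀ ⊆ Set.Ici 0 := Set.Ici_subset_Ici.mpr ht₀
  have cp : ∀ k, ContinuousOn (p k) (Set.Ici t₀) := fun k => (h.1 k).continuousOn_pos
  have cpd : ∀ k, ContinuousOn (pd k) (Set.Ici t₀) := fun k => (hd k).continuousOn_pos.mono hsub
  have cv : ∀ k, ContinuousOn (v k) (Set.Ici t₀) := fun k => (h.1 k).continuousOn_vel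
  have cvd : ∀ k, ContinuousOn (vd k) (Set.Ici t₀) := fun k => (hd k).continuousOn_vel.mono hsub
  have cle : ∀ k, ContinuousOn (leaderError r pd p k) (Set.Ici t₀) := fun k =>
    ((cp k).sub (cpd k)).sub ((cp r).sub (cpd r))
  have clv : ∀ k, ContinuousOn (leaderError r vd v k) (Set.Ici t₀) := fun k =>
    ((cv k).sub (cvd k)).sub ((cv r).sub (cvd r))
  have key : ∀ k, ∀ t ≥ t₀, HasDerivWithinAt (fun t => v k t - vd k t)
      (accel (nbrs G k) (kp k) (kd k)
        (fun j => rel pd k j t - (leaderError r pd p k t - leaderError r pd p j t))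
        (fun j => leaderError r pd p j t) (fun j => leaderError r vd v j t)
        (leaderError r pd p k t) (leaderError r vd v k t)) (Set.Ici t₀) t := by
    intro k
    refine (h.1 k).hasDerivWithinAt_vel_sub ht₀ (hd k) ?_ fun t _ => control_eq k t
    refine continuousOn_finsetSum _ fun j hj => ?_
    have hq : ContinuousOn (fun t => proj (bearing (rel p k j t))) (Set.Ici t₀) :=
      continuousOn_proj_bearing ((cp j).sub (cp k)) (h.2 k j (mem_nbrs.mp hj))
    have hp : ContinuousOn (fun t => kp k • proj (bearing (rel p k j t))
        (leaderError r pd p j t - leaderError r pd p k t)) (Set.Ici t₀) :=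
      (hq.clm_apply ((cle j).sub (cle k))).const_smul (kp k)
    have hv : ContinuousOn (fun t => kd k • (leaderError r vd v j t - leaderError r vd v k t))
        (Set.Ici t₀) := ((clv j).sub (clv k)).const_smul (kd k)
    simp only [rel_eq]
    exact hp.add hv
  intro t ht
  have h1 := (key i t ht).sub (key r t ht)
  refine h1.congr_deriv ?_
  rw [hG.nbrs_leader]
  simp only [accel, Finset.sum_empty, sub_zero]

/-! ### Induction along the cascade -/

/-- The errors of agent `i` relative to the leader decay with rate `c` and constant `K` along all
closed-loop motions whose initial cascade error is at most `R`. -/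
def AgentDecay (G : Digraph (Fin n)) (r : Fin n) (kp kd : Fin n → ℝ)
    (pd vd ud : Fin n → ℝ → E3) (R : ℝ) (i : Fin n) (K c : ℝ) : Prop :=
  ∀ t₀ : ℝ, 0 ≤ t₀ → ∀ p v : Fin n → ℝ → E3, IsClosedLoopSolution G kp kd pd vd ud t₀ p v →
    cascadeErrorNorm G pd vd p v i t₀ ≤ R → ∀ t ≥ t₀,
      ‖leaderError r pd p i t‖
          ≤ K * cascadeErrorNorm G pd vd p v i t₀ * Real.exp (-c * (t - t₀)) ∧
        ‖leaderError r vd v i t‖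
          ≤ K * cascadeErrorNorm G pd vd p v i t₀ * Real.exp (-c * (t - t₀))

lemma AgentDecay.mono {R K K' c c' : ℝ} {i : Fin n} (hK0 : 0 ≤ K) (hK : K ≤ K') (hc : c' ≤ c)
    (h : AgentDecay G r kp kd pd vd ud R i K c) : AgentDecay G r kp kd pd vd ud R i K' c' := by
  intro t₀ ht₀ p v hsol hR t ht
  have hX := cascadeErrorNorm_nonneg (G := G) pd vd p v i t₀
  have hle : K * cascadeErrorNorm G pd vd p v i t₀ * Real.exp (-c * (t - t₀))
      ≤ K' * cascadeErrorNorm G pd vd p v i t₀ * Real.exp (-c' * (t - t₀)) := by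
    have h1 : Real.exp (-c * (t - t₀)) ≤ Real.exp (-c' * (t - t₀)) :=
      Real.exp_le_exp.mpr (by nlinarith)
    have : 0 ≤ K' := hK0.trans hK
    gcongr
  obtain ⟨h1, h2⟩ := h t₀ ht₀ p v hsol hR t ht
  exact ⟨h1.trans hle, h2.trans hle⟩

lemma exists_agentDecay_uniform {R : ℝ} (N : Finset (Fin n))
    (h : ∀ j ∈ N, ∃ K > 0, ∃ c > 0, AgentDecay G r kp kd pd vd ud R j K c) :
    ∃ K > 0, ∃ c > 0, ∀ j ∈ N, AgentDecay G r kp kd pd vd ud R j K c := by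
  induction N using Finset.induction_on with
  | empty => exact ⟨1, one_pos, 1, one_pos, by simp⟩
  | insert a N _ ih =>
    obtain ⟨K, hK, c, hc, hN⟩ := ih fun j hj => h j (Finset.mem_insert_of_mem hj)
    obtain ⟨K', hK', c', hc', ha⟩ := h a (Finset.mem_insert_self a N)
    refine ⟨max K K', lt_max_of_lt_left hK, min c c', lt_min hc hc', fun j hj => ?_⟩
    rcases Finset.mem_insert.mp hj with rfl | hj
    · exact ha.mono hK'.le (le_max_right _ _) (min_le_right _ _)
    · exact (hN j hj).mono hK.le (le_max_left _ _) (min_le_left _ _)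

/-- The gain condition implies `kp * m < (kd * m) ^ 2` by `4 - 4 / a ^ 2 ≤ a ^ 2`, which is
`(a ^ 2 - 2) ^ 2 ≥ 0`. -/
lemma gain_lt_of_gain_condition {m kp kd : ℝ} (hm : 0 < m) (hkd : 0 < kd)
    (h : kp < 4 / m - 4 / (kd ^ 2 * m ^ 3)) : kp < kd ^ 2 * m := by
  refine h.trans_le ?_
  rw [sub_le_iff_le_add, div_le_iff₀ hm]
  have h1 : (kd ^ 2 * m + 4 / (kd ^ 2 * m ^ 3)) * m - 4
      = (kd ^ 2 * m ^ 2 - 2) ^ 2 / (kd ^ 2 * m ^ 2) := by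
    field_simp
    ring
  have h2 : 0 ≤ (kd ^ 2 * m ^ 2 - 2) ^ 2 / (kd ^ 2 * m ^ 2) := by positivity
  linarith

lemma exists_agentDecay (hG : IsLeaderFollower G r)
    (hgain : ∀ i, i ≠ r → 0 < kp i ∧ 0 < kd i ∧ 1 / (outDeg G i : ℝ) < kd i ∧
      kp i < 4 / (outDeg G i : ℝ) - 4 / (kd i ^ 2 * (outDeg G i : ℝ) ^ 3))
    (hd : ∀ i, IsDoubleIntegrator 0 (pd i) (vd i) (ud i))
    {δ : ℝ} (hδ : 0 < δ) (hsep : ∀ i j, G.Adj i j → ∀ t : ℝ, 0 < t → δ ≤ ‖rel pd i j t‖)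
    (hPE : IsBearingPE G r pd) {R : ℝ} (hR : 0 ≤ R) (i : Fin n) :
    ∃ K > 0, ∃ c > 0, AgentDecay G r kp kd pd vd ud R i K c := by
  induction i using hG.1.wellFounded.induction with
  | _ i ih =>
  rcases eq_or_ne i r with rfl | hi
  · refine ⟨1, one_pos, 1, one_pos, fun t₀ _ p v _ _ t _ => ?_⟩
    have := cascadeErrorNorm_nonneg (G := G) pd vd p v i t₀
    simp only [leaderError, sub_self, norm_zero]
    constructor <;> positivity
  obtain ⟨K, hK, c, hc, hnb⟩ := exists_agentDecay_uniform (nbrs G i)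
    fun j hj => ih j (mem_nbrs.mp hj)
  obtain ⟨hkp, hkd, hkd1, hkp1⟩ := hgain i hi
  have hN := hG.nbrs_nonempty hi
  have hm : (0 : ℝ) < outDeg G i := by exact_mod_cast hN.card_pos
  have ha : 1 ≤ kd i * (nbrs G i).card := by
    rw [div_lt_iff₀ hm] at hkd1
    exact hkd1.le
  have hcont : ∀ j ∈ nbrs G i, ContinuousOn (rel pd i j) (Set.Ioi 0) := fun j _ =>
    ((hd j).continuousOn_pos.sub (hd i).continuousOn_pos).mono Set.Ioi_subset_Ici_self
  obtain ⟨K', hK', c', hc', hdec⟩ := exists_decay_of_driven hN hkp hkd ha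
    (gain_lt_of_gain_condition hm hkd hkp1) hcont hδ
    (fun j hj t ht => hsep i j (mem_nbrs.mp hj) t ht) (hPE i hi) hc
    (R := (K + 1) * R) (by positivity)
  refine ⟨K' * (K + 1), by positivity, c', hc', fun t₀ ht₀ p v hsol hXR => ?_⟩
  set X := cascadeErrorNorm G pd vd p v i t₀ with hX
  have hX0 : 0 ≤ X := cascadeErrorNorm_nonneg pd vd p v i t₀
  have hbound : ∀ j ∈ nbrs G i, ∀ t ≥ t₀,
      ‖leaderError r pd p j t‖ ≤ K * X * Real.exp (-c * (t - t₀)) ∧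
        ‖leaderError r vd v j t‖ ≤ K * X * Real.exp (-c * (t - t₀)) := by
    intro j hj t ht
    have hXj := cascadeErrorNorm_le_of_adj pd vd p v (mem_nbrs.mp hj) t₀
    obtain ⟨h1, h2⟩ := hnb j hj t₀ ht₀ p v hsol (hXj.trans hXR) t ht
    exact ⟨h1.trans (by gcongr), h2.trans (by gcongr)⟩
  have hinit : ‖leaderError r pd p i t₀‖ ≤ (K + 1) * X ∧
      ‖leaderError r vd v i t₀‖ ≤ (K + 1) * X := by
    obtain ⟨j, hj⟩ := hN
    obtain ⟨h1, h2⟩ := hbound j hj t₀ le_rfl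
    rw [sub_self, mul_zero, Real.exp_zero, mul_one] at h1 h2
    have h3 := relError_le_cascadeErrorNorm pd vd p v (mem_nbrs.mp hj) t₀
    have h4 := (norm_pos_le_relError pd vd p v i j t₀).trans h3
    have h5 := (norm_vel_le_relError pd vd p v i j t₀).trans h3
    rw [rel_sub_rel r, norm_sub_rev] at h4 h5
    constructor
    · linarith [norm_le_norm_add_norm_sub' (leaderError r pd p i t₀) (leaderError r pd p j t₀)]
    · linarith [norm_le_norm_add_norm_sub' (leaderError r vd v i t₀) (leaderError r vd v j t₀)]
  have hmot : IsDrivenMotion (nbrs G i) (kp i) (kd i) (rel pd i) c ((K + 1) * X) t₀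
      (leaderError r pd p) (leaderError r vd v) (leaderError r pd p i) (leaderError r vd v i) :=
    { deriv_pos := hsol.hasDerivWithinAt_pos ht₀ hd i
      deriv_vel := hsol.hasDerivWithinAt_vel hG ht₀ hd i
      continuousOn_pos := fun j _ t ht =>
        (hsol.hasDerivWithinAt_pos ht₀ hd j t ht).continuousWithinAt
      ne_zero := fun j hj t ht => by
        rw [rel_eq]
        exact hsol.2 i j (mem_nbrs.mp hj) t ht
      nonneg := by positivity
      bound := fun j hj t ht => by
        obtain ⟨h1, h2⟩ := hbound j hj t ht
        have hle : K * X * Real.exp (-c * (t - t₀)) ≤ (K + 1) * X * Real.exp (-c * (t - t₀)) := by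
          gcongr
          linarith
        exact ⟨h1.trans hle, h2.trans hle⟩ }
  intro t ht
  have := hdec ((K + 1) * X) t₀ _ _ _ _ ht₀ (by gcongr) hmot hinit.1 hinit.2 t ht
  rwa [← mul_assoc] at this

end BearingFormation

theorem mainTheorem1
    (n : ℕ) (hn : 2 ≤ n) (G : Digraph (Fin n)) (r : Fin n)
    (hG : BearingFormation.IsLeaderFollower G r)
    (kp kd : Fin n → ℝ)
    (hgain : ∀ i, i ≠ r → 0 < kp i ∧ 0 < kd i ∧
      1 / (BearingFormation.outDeg G i : ℝ) < kd i ∧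
      kp i < 4 / (BearingFormation.outDeg G i : ℝ)
        - 4 / (kd i ^ 2 * (BearingFormation.outDeg G i : ℝ) ^ 3))
    (pd vd ud : Fin n → ℝ → BearingFormation.E3)
    (hdesired : ∀ i, BearingFormation.IsDoubleIntegrator 0 (pd i) (vd i) (ud i))
    (hu : ∃ C : ℝ, ∀ i, ∀ t : ℝ, 0 < t → ‖ud i t‖ ≤ C)
    (hv : ∃ C : ℝ, ∀ i j, G.Adj i j → ∀ t : ℝ, 0 < t → ‖BearingFormation.rel vd i j t‖ ≤ C)
    (hsep : ∃ δ : ℝ, 0 < δ ∧ ∀ i j, G.Adj i j → ∀ t : ℝ, 0 < t → δ ≤ ‖BearingFormation.rel pd i j t‖)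
    (hPE : BearingFormation.IsBearingPE G r pd) :
    ∀ i, i ≠ r → ∀ R : ℝ, 0 < R → ∃ K : ℝ, 0 < K ∧ ∃ c : ℝ, 0 < c ∧
      ∀ t₀ : ℝ, 0 ≤ t₀ → ∀ p v : Fin n → ℝ → BearingFormation.E3,
      BearingFormation.IsClosedLoopSolution G kp kd pd vd ud t₀ p v →
      BearingFormation.cascadeErrorNorm G pd vd p v i t₀ ≤ R →
      ∀ j ∈ BearingFormation.nbrs G i, ∀ t : ℝ, t₀ ≤ t →
        ‖BearingFormation.relError pd vd p v i j t‖
          ≤ K * BearingFormation.cascadeErrorNorm G pd vd p v i t₀ * Real.exp (-c * (t - t₀)) := by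
  intro i hi R hR
  obtain ⟨δ, hδ, hsep⟩ := hsep
  obtain ⟨K, hK, c, hc, hdec⟩ := BearingFormation.exists_agentDecay_uniform Finset.univ
    fun j _ => BearingFormation.exists_agentDecay hG hgain hdesired hδ hsep hPE hR.le j
  refine ⟨4 * K, by positivity, c, hc, fun t₀ ht₀ p v hsol hXR j hj t ht => ?_⟩
  have hij := BearingFormation.mem_nbrs.mp hj
  have hXj := BearingFormation.cascadeErrorNorm_le_of_adj pd vd p v hij t₀
  obtain ⟨h1, h2⟩ := hdec i (Finset.mem_univ i) t₀ ht₀ p v hsol hXR t ht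
  obtain ⟨h3, h4⟩ := hdec j (Finset.mem_univ j) t₀ ht₀ p v hsol (hXj.trans hXR) t ht
  have hle : K * BearingFormation.cascadeErrorNorm G pd vd p v j t₀ * Real.exp (-c * (t - t₀))
      ≤ K * BearingFormation.cascadeErrorNorm G pd vd p v i t₀ * Real.exp (-c * (t - t₀)) := by
    gcongr
  refine (BearingFormation.norm_relError_le pd vd p v i j t).trans ?_
  rw [BearingFormation.rel_sub_rel r, BearingFormation.rel_sub_rel r]
  linarith [norm_sub_le (BearingFormation.leaderError r pd p j t)
      (BearingFormation.leaderError r pd p i t),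
    norm_sub_le (BearingFormation.leaderError r vd v j t)
      (BearingFormation.leaderError r vd v i t)]
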